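/- Let $n\ge 2$, $T>0$ and $\Sigma=(0,T)\times\mathbb R^n$. Let $(r,p)$ be a Strichartz pair, i.e. $r,p\in[2,\infty]$, $\frac2r+\frac np=\frac n2$ and $(n,r,p)\ne(2,2,\infty)$ (so for $n\ge 3$ the endpoint $r=2$, $p=\frac{2n}{n-2}$ is allowed), and let $r',p'$ be the Hölder conjugate exponents. Let $$v\in C\big([0,T];L^p(\mathbb R^n)\big),\qquad u\in C\big([0,T];L^2(\mathbb R^n)\big)\cap L^r\big((0,T);L^p(\mathbb R^n)\big)\quad\text{with}\quad u(0,\cdot)=u(T,\cdot)=0,$$ be complex-valued and such that, in the sense of distributions on $\Sigma$, $$(i\partial_t+\Delta)u,\ (i\partial_t+\Delta)v\in L^{r'}\big((0,T);L^{p'}(\mathbb R^n)\big).$$ Then the functions $\big((i\partial_t+\Delta)u\big)\,\overline{v}$ and $u\,\overline{(i\partial_t+\Delta)v}$ are integrable on $\Sigma$, and $$\int_\Sigma (i\partial_t+\Delta)u\;\overline v=\int_\Sigma u\;\overline{(i\partial_t+\Delta)v}.$$ -/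

import Mathlib

open MeasureTheory Set Filter Topology
open scoped ENNReal ContDiff

/-- The space `ℝⁿ` with its Euclidean norm and Lebesgue measure. -/
abbrev Rn (n : ℕ) : Type := EuclideanSpace ℝ (Fin n)

/-- The open space-time slab `(0,T) × ℝⁿ`. -/
def slab (n : ℕ) (T : ℝ) : Set (ℝ × Rn n) := Ioo 0 T ×ˢ univ

/-- `(r, p)` is a Strichartz pair in dimension `n`:
`2/r + n/p = n/2` with `r, p ∈ [2, ∞]` and `(n, r, p) ≠ (2, 2, ∞)`. -/
def IsStrichartzPair (n : ℕ) (r p : ℝ≥0∞) : Prop :=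
  2 / r + (n : ℝ≥0∞) / p = (n : ℝ≥0∞) / 2 ∧ 2 ≤ r ∧ 2 ≤ p ∧ ¬ (n = 2 ∧ r = 2 ∧ p = ⊤)

/-- The mixed norm of `L^r((0,T); L^p(ℝⁿ))`, the `L^r(0,T)` norm of `t ↦ ‖u(t,·)‖_{L^p(ℝⁿ)}`
(an essential supremum in `t` if `r = ∞`). -/
noncomputable def mixedNorm {n : ℕ} (T : ℝ) (r p : ℝ≥0∞) (u : ℝ × Rn n → ℂ) : ℝ≥0∞ :=
  eLpNorm (fun t : ℝ => eLpNorm (fun x : Rn n => u (t, x)) p volume) r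
    (volume.restrict (Ioo 0 T))

/-- `u` represents an element of `L^r((0,T); L^p(ℝⁿ))`. -/
def MemMixed {n : ℕ} (T : ℝ) (r p : ℝ≥0∞) (u : ℝ × Rn n → ℂ) : Prop :=
  AEStronglyMeasurable u (volume.restrict (slab n T)) ∧ mixedNorm T r p u < ⊤

/-- `u` represents an element of `C([0,T]; L^q(ℝⁿ))`: it is measurable in `(t,x)`, every slice
`u(t,·)` with `t ∈ [0,T]` lies in `L^q(ℝⁿ)`, and `t ↦ u(t,·)` is continuous on `[0,T]` for the
`L^q` norm. -/
def MemContLp {n : ℕ} (T : ℝ) (q : ℝ≥0∞) (u : ℝ × Rn n → ℂ) : Prop :=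
  AEStronglyMeasurable u (volume.restrict (slab n T)) ∧
  (∀ t ∈ Icc 0 T, MemLp (fun x : Rn n => u (t, x)) q volume) ∧
  ∀ t₀ ∈ Icc 0 T,
    Tendsto (fun t => eLpNorm (fun x : Rn n => u (t, x) - u (t₀, x)) q volume)
      (𝓝[Icc 0 T] t₀) (𝓝 0)

/-- The formal transpose `-i ∂ₜ + Δ` of `i ∂ₜ + Δ`, applied to a smooth function `φ(t,x)`;
`Δ` acts in `x` only. -/
noncomputable def transposeSchrodinger {n : ℕ} (φ : ℝ × Rn n → ℂ) (z : ℝ × Rn n) : ℂ :=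
  -Complex.I * deriv (fun s : ℝ => φ (s, z.2)) z.1
    + Laplacian.laplacian (fun x : Rn n => φ (z.1, x)) z.2

/-- `(i ∂ₜ + Δ) u = F` in the sense of distributions on `(0,T) × ℝⁿ`. -/
def IsSchrodingerOf {n : ℕ} (T : ℝ) (u F : ℝ × Rn n → ℂ) : Prop :=
  ∀ φ : ℝ × Rn n → ℂ, ContDiff ℝ ∞ φ → HasCompactSupport φ → tsupport φ ⊆ slab n T →
    ∫ z in slab n T, u z * transposeSchrodinger φ z = ∫ z in slab n T, F z * φ z

/-! The difficulty is that neither function may be used as a test function in the other's equation.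
The proof doubles the variables: the equation for `u` at `(t,x)` and the conjugated equation for `v`
at `(s,y)` are both tested against `χ(t) θ(t-s) η(x) ρ(y-x)`, with `χ`, `η` cutoffs and `θ` a
mollifier. On subtracting, the terms with `θ'` and with `Δρ` cancel, because `∂ₜ + ∂ₛ` annihilates
`θ(t-s)` and `Δₓ - Δ_y` annihilates `ρ(y-x)`. Only terms with a derivative on a cutoff survive
(`doubled_identity`).

With `ρ` and `η` fixed, the time scale tends to zero (`localized_identity`). The spatial kernel
makes one factor bounded and continuous in time, so the main terms converge to the time diagonal.
The `χ'` term vanishes since `χ'` has bounded mass concentrating at `0` and `T`, where the `L²` norm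
of `u` tends to zero.

Next `η` is spread to scale `R → ∞` (`tendsto_commutator`). The commutator is `O(1/R)` on the
annulus `R ≤ |x| ≤ 2R`. Hölder with `1/q = 1/2 - 1/p` pairs `u ∈ L²`, `v ∈ L^p` and this weight in
`L^q`, whose norm is of order at most `R^(n/q - 1)`. Admissibility gives `n/q = 2/r ≤ 1`, so this
stays bounded, and the `L²` tail of `u` supplies the decay.

What remains holds for every test function `ρ` and says that two correlation functions of the shift
`ζ = y - x` agree almost everywhere. Both are continuous, as translations are continuous in `L^p`
for `p < ∞` (`IsPaired.continuous_integral_translate`), so they agree at `ζ = 0`, which is the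
claim. -/

theorem volume_restrict_slab (n : ℕ) (T : ℝ) :
    (volume : Measure (ℝ × Rn n)).restrict (slab n T) =
      ((volume : Measure ℝ).restrict (Ioo 0 T)).prod volume := by
  rw [slab, Measure.volume_eq_prod, ← Measure.prod_restrict, Measure.restrict_univ]

/-! ### Slices, Hölder inequalities and continuity of translations. -/

section Slices

variable {n : ℕ} {ν : Measure ℝ}

theorem aemeasurable_eLpNorm_slice {f : ℝ × Rn n → ℂ} {p : ℝ≥0∞}
    (hf : AEStronglyMeasurable f (ν.prod volume)) (hp0 : p ≠ 0) (hp : p ≠ ⊤) :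
    AEMeasurable (fun t => eLpNorm (fun x => f (t, x)) p volume) ν := by
  simp only [eLpNorm_eq_lintegral_rpow_enorm_toReal hp0 hp]
  exact ((hf.enorm.pow_const _).lintegral_prod_right').pow_const _

theorem ae_aestronglyMeasurable_slice {f : ℝ × Rn n → ℂ}
    (hf : AEStronglyMeasurable f (ν.prod volume)) :
    ∀ᵐ t ∂ν, AEStronglyMeasurable (fun x => f (t, x)) volume :=
  hf.prodMk_left

end Slices

theorem lintegral_enorm_mul_enorm_le {α : Type*} {m : MeasurableSpace α} {μ : Measure α}
    {p q : ℝ≥0∞} [p.HolderConjugate q] {f g : α → ℂ} (hf : AEStronglyMeasurable f μ)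
    (hg : AEStronglyMeasurable g μ) :
    ∫⁻ x, ‖f x‖ₑ * ‖g x‖ₑ ∂μ ≤ eLpNorm f p μ * eLpNorm g q μ := by
  have := eLpNorm_smul_le_mul_eLpNorm (p := p) (q := q) (r := 1) hg hf
  rw [eLpNorm_one_eq_lintegral_enorm] at this
  simpa [enorm_mul] using this

/-- Hölder in time, applied to the `ℝ≥0∞`-valued functions `t ↦ ‖f(t,·)‖`. The pair `(1, ∞)` is
treated separately because functions continuous in time are paired through it. -/
theorem lintegral_mul_lt_top_of_eLpNorm {α : Type*} {m : MeasurableSpace α} {μ : Measure α}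
    {p q : ℝ≥0∞} [p.HolderConjugate q] {f g : α → ℝ≥0∞} (hf : AEMeasurable f μ)
    (hg : AEMeasurable g μ) (hf' : eLpNorm f p μ < ⊤) (hg' : eLpNorm g q μ < ⊤) :
    ∫⁻ x, f x * g x ∂μ < ⊤ := by
  have key : ∀ {f g : α → ℝ≥0∞}, eLpNorm f ⊤ μ < ⊤ → eLpNorm g 1 μ < ⊤ →
      ∫⁻ x, f x * g x ∂μ < ⊤ := by
    intro f g hf hg
    rw [eLpNorm_exponent_top] at hf
    rw [eLpNorm_one_eq_lintegral_enorm] at hg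
    simp only [enorm_eq_self] at hg
    calc ∫⁻ x, f x * g x ∂μ ≤ ∫⁻ x, eLpNormEssSup f μ * g x ∂μ := by
          refine lintegral_mono_ae ?_
          filter_upwards [enorm_ae_le_eLpNormEssSup f μ] with x hx
          gcongr
          simpa using hx
      _ = eLpNormEssSup f μ * ∫⁻ x, g x ∂μ := lintegral_const_mul' _ _ hf.ne
      _ < ⊤ := ENNReal.mul_lt_top hf hg
  rcases eq_or_ne p ⊤ with rfl | hp
  · obtain rfl := ENNReal.HolderConjugate.unique ⊤ q 1
    exact key hf' hg'
  rcases eq_or_ne q ⊤ with rfl | hq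
  · have : ENNReal.HolderConjugate ⊤ p := ENNReal.HolderConjugate.symm
    obtain rfl := ENNReal.HolderConjugate.unique ⊤ p 1
    simp only [mul_comm (f _)]
    exact key hg' hf'
  have hpq := ENNReal.HolderConjugate.toReal_of_ne_top (p := p) (q := q) hp hq
  have hp0 : p ≠ 0 := ENNReal.HolderConjugate.ne_zero p q
  have hq0 : q ≠ 0 := ENNReal.HolderConjugate.ne_zero q p
  rw [eLpNorm_eq_lintegral_rpow_enorm_toReal hp0 hp] at hf'
  rw [eLpNorm_eq_lintegral_rpow_enorm_toReal hq0 hq] at hg'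
  simp only [enorm_eq_self] at hf' hg'
  exact (ENNReal.lintegral_mul_le_Lp_mul_Lq μ hpq hf hg).trans_lt (ENNReal.mul_lt_top hf' hg')

/-- Translations form a continuous family of measure-preserving maps, and composition with such a
family is continuous in `L^p` for finite `p`. -/
theorem tendsto_eLpNorm_translate_sub {n : ℕ} {p : ℝ≥0∞} [Fact (1 ≤ p)] (hp : p ≠ ⊤)
    {f : Rn n → ℂ} (hf : MemLp f p volume) (a : Rn n) :
    Tendsto (fun ζ => eLpNorm (fun x => f (x + ζ) - f (x + a)) p volume) (𝓝 a) (𝓝 0) := by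
  let g : Rn n → C(Rn n, Rn n) := fun ζ => ⟨fun x => x + ζ, by fun_prop⟩
  have hg : Continuous g := ContinuousMap.continuous_of_continuous_uncurry _ (by
    show Continuous fun z : Rn n × Rn n => z.2 + z.1
    fun_prop)
  have hgm : ∀ ζ, MeasurePreserving (g ζ) volume volume := fun ζ =>
    measurePreserving_add_right volume ζ
  have h := Filter.Tendsto.compMeasurePreservingLp (tendsto_const_nhds (x := hf.toLp f))
    (hg.tendsto a) hgm (hgm a) hp
  rw [tendsto_iff_edist_tendsto_0] at h
  refine h.congr fun ζ => ?_
  rw [Lp.toLp_compMeasurePreserving, Lp.toLp_compMeasurePreserving, Lp.edist_toLp_toLp]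
  rfl

/-! ### Space-time pairings and their spatial translates. -/

/-- Two functions of `(t, x)` whose slices are Hölder dual, with integrable product of norms. -/
structure IsPaired {n : ℕ} (ν : Measure ℝ) (p q : ℝ≥0∞) (a b : ℝ × Rn n → ℂ) : Prop where
  left_meas : AEStronglyMeasurable a (ν.prod volume)
  right_meas : AEStronglyMeasurable b (ν.prod volume)
  left_slice : ∀ᵐ t ∂ν, MemLp (fun x => a (t, x)) p volume
  right_slice : ∀ᵐ t ∂ν, MemLp (fun x => b (t, x)) q volume
  lintegral_lt_top : ∫⁻ t, eLpNorm (fun x => a (t, x)) p volume *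
    eLpNorm (fun x => b (t, x)) q volume ∂ν < ⊤

section Pairing

variable {n : ℕ} {ν : Measure ℝ}

/-- Transfers a.e. measurability of `b` to `b(t,y)` as a function of `(t,x,y)`. Dropping `x` does
not preserve measure, but a null set in `(t,y)` has null `y`-slices for a.e. `t`, which suffices. -/
theorem quasiMeasurePreserving_replace_snd :
    Measure.QuasiMeasurePreserving (fun w : (ℝ × Rn n) × Rn n => (w.1.1, w.2))
      ((ν.prod volume).prod volume) (ν.prod volume) := by
  refine ⟨by fun_prop, Measure.AbsolutelyContinuous.mk fun s hs h => ?_⟩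
  rw [Measure.map_apply (by fun_prop) hs, Measure.measure_prod_null (hs.preimage (by fun_prop))]
  exact Measure.quasiMeasurePreserving_fst.ae ((Measure.measure_prod_null hs).1 h)

theorem IsPaired.lintegral_slice_le {p q : ℝ≥0∞} [p.HolderConjugate q] {a b : ℝ × Rn n → ℂ}
    (h : IsPaired ν p q a b) :
    ∀ᵐ t ∂ν, ∀ ζ : Rn n, ∫⁻ x, ‖a (t, x)‖ₑ * ‖b (t, x + ζ)‖ₑ ≤
      eLpNorm (fun x => a (t, x)) p volume * eLpNorm (fun x => b (t, x)) q volume := by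
  filter_upwards [h.left_slice, h.right_slice] with t ha hb ζ
  have hζ := measurePreserving_add_right (volume : Measure (Rn n)) ζ
  refine (lintegral_enorm_mul_enorm_le (p := p) (q := q) ha.1
    (hb.1.comp_measurePreserving hζ)).trans_eq ?_
  rw [← eLpNorm_comp_measurePreserving hb.1 hζ]

variable [SFinite ν]

theorem measurePreserving_translate_snd (ζ : Rn n) :
    MeasurePreserving (fun z : ℝ × Rn n => (z.1, z.2 + ζ)) (ν.prod volume) (ν.prod volume) :=
  (MeasurePreserving.id ν).prod (measurePreserving_add_right volume ζ)

theorem measurePreserving_shear :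
    MeasurePreserving (fun w : (ℝ × Rn n) × Rn n => (w.1, w.1.2 + w.2))
      ((ν.prod volume).prod volume) ((ν.prod volume).prod volume) :=
  (MeasurePreserving.id (ν.prod volume)).skew_product (g := fun z y => z.2 + y)
    (by fun_prop) (Eventually.of_forall fun z => (measurePreserving_add_left volume z.2).map_eq)

theorem quasiMeasurePreserving_translate :
    Measure.QuasiMeasurePreserving (fun w : (ℝ × Rn n) × Rn n => (w.1.1, w.1.2 + w.2))
      ((ν.prod volume).prod volume) (ν.prod volume) :=
  quasiMeasurePreserving_replace_snd.comp measurePreserving_shear.quasiMeasurePreserving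

namespace IsPaired

variable {p q : ℝ≥0∞} {a b : ℝ × Rn n → ℂ}

variable [p.HolderConjugate q]

theorem lintegral_translate_le (h : IsPaired ν p q a b) (ζ : Rn n) :
    ∫⁻ z, ‖a z‖ₑ * ‖b (z.1, z.2 + ζ)‖ₑ ∂(ν.prod volume) ≤
      ∫⁻ t, eLpNorm (fun x => a (t, x)) p volume * eLpNorm (fun x => b (t, x)) q volume ∂ν := by
  have hm : AEMeasurable (fun z : ℝ × Rn n => ‖a z‖ₑ * ‖b (z.1, z.2 + ζ)‖ₑ) (ν.prod volume) :=
    h.left_meas.enorm.mul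
      (h.right_meas.comp_measurePreserving (measurePreserving_translate_snd ζ)).enorm
  rw [lintegral_prod _ hm]
  refine lintegral_mono_ae ?_
  filter_upwards [h.lintegral_slice_le] with t ht using ht ζ

theorem integrable_translate (h : IsPaired ν p q a b) (ζ : Rn n) :
    Integrable (fun z : ℝ × Rn n => a z * b (z.1, z.2 + ζ)) (ν.prod volume) := by
  refine ⟨h.left_meas.mul
    (h.right_meas.comp_measurePreserving (measurePreserving_translate_snd ζ)), ?_⟩
  simp only [HasFiniteIntegral, enorm_mul]
  exact (h.lintegral_translate_le ζ).trans_lt h.lintegral_lt_top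

theorem integrable_mul (h : IsPaired ν p q a b) :
    Integrable (fun z : ℝ × Rn n => a z * b z) (ν.prod volume) := by
  simpa using h.integrable_translate 0

/-- Slicewise Hölder bounds the inner integral uniformly in the shift, because translations preserve
the `L^q` norm; the kernel then contributes only its mass. -/
theorem lintegral_translate_kernel_le (h : IsPaired ν p q a b) {ρ : Rn n → ℝ}
    (hρ : AEStronglyMeasurable ρ volume) :
    ∫⁻ w, ‖a w.1‖ₑ * ‖b (w.1.1, w.1.2 + w.2)‖ₑ * ‖ρ w.2‖ₑ ∂((ν.prod volume).prod volume) ≤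
      (∫⁻ t, eLpNorm (fun x => a (t, x)) p volume * eLpNorm (fun x => b (t, x)) q volume ∂ν) *
        ∫⁻ ζ, ‖ρ ζ‖ₑ := by
  have hm : AEMeasurable (fun w : (ℝ × Rn n) × Rn n =>
      ‖a w.1‖ₑ * ‖b (w.1.1, w.1.2 + w.2)‖ₑ * ‖ρ w.2‖ₑ) ((ν.prod volume).prod volume) :=
    (h.left_meas.comp_fst.enorm.mul
      (h.right_meas.comp_quasiMeasurePreserving quasiMeasurePreserving_translate).enorm).mul
      hρ.comp_snd.enorm
  rw [lintegral_prod_symm _ hm, ← lintegral_const_mul'' _ hρ.enorm]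
  refine lintegral_mono fun ζ => ?_
  simp only
  rw [lintegral_mul_const' _ _ enorm_ne_top]
  gcongr
  exact h.lintegral_translate_le ζ

theorem integrable_translate_kernel (h : IsPaired ν p q a b) {ρ : Rn n → ℝ}
    (hρ : Integrable ρ volume) :
    Integrable (fun w : (ℝ × Rn n) × Rn n => a w.1 * b (w.1.1, w.1.2 + w.2) * (ρ w.2 : ℂ))
      ((ν.prod volume).prod volume) := by
  refine ⟨(h.left_meas.comp_fst.mul
    (h.right_meas.comp_quasiMeasurePreserving quasiMeasurePreserving_translate)).mul
    (Complex.continuous_ofReal.comp_aestronglyMeasurable hρ.1.comp_snd), ?_⟩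
  have : ∀ x : ℝ, ‖(x : ℂ)‖ₑ = ‖x‖ₑ := fun x => by
    rw [← ofReal_norm, ← ofReal_norm, Complex.norm_real]
  simp only [HasFiniteIntegral, enorm_mul, this]
  exact (h.lintegral_translate_kernel_le hρ.1).trans_lt
    (ENNReal.mul_lt_top h.lintegral_lt_top hρ.2)

theorem integrable_kernel (h : IsPaired ν p q a b) {ρ : Rn n → ℝ} (hρ : Integrable ρ volume) :
    Integrable (fun w : (ℝ × Rn n) × Rn n => a w.1 * b (w.1.1, w.2) * (ρ (w.2 - w.1.2) : ℂ))
      ((ν.prod volume).prod volume) := by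
  have hs : MeasurePreserving (fun w : (ℝ × Rn n) × Rn n => (w.1, -w.1.2 + w.2))
      ((ν.prod volume).prod volume) ((ν.prod volume).prod volume) :=
    (MeasurePreserving.id (ν.prod volume)).skew_product (g := fun z y => -z.2 + y)
      (by fun_prop) (Eventually.of_forall fun z =>
        (measurePreserving_add_left volume (-z.2)).map_eq)
  refine (hs.integrable_comp_of_integrable (h.integrable_translate_kernel hρ)).congr
    (Eventually.of_forall fun w => ?_)
  simp [sub_eq_add_neg, add_comm]

/-- The substitution `y = x + ζ` and Fubini exhibit the smoothed pairing as the correlation function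
of `a` and `b` tested against `ρ`. This lets an identity for all `ρ` be read at zero shift. -/
theorem integral_kernel_eq (h : IsPaired ν p q a b) {ρ : Rn n → ℝ} (hρ : Integrable ρ volume) :
    ∫ z, (a z * ∫ y, b (z.1, y) * (ρ (y - z.2) : ℂ)) ∂(ν.prod volume) =
      ∫ ζ, (ρ ζ : ℂ) * ∫ z, a z * b (z.1, z.2 + ζ) ∂(ν.prod volume) := by
  have h1 : ∀ z : ℝ × Rn n, a z * ∫ y, b (z.1, y) * (ρ (y - z.2) : ℂ) =
      ∫ ζ, a z * b (z.1, z.2 + ζ) * (ρ ζ : ℂ) := by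
    intro z
    rw [← integral_add_left_eq_self (μ := volume) (fun y : Rn n => b (z.1, y) * (ρ (y - z.2) : ℂ)) z.2, ← integral_const_mul]
    simp only [add_sub_cancel_left, mul_assoc]
  simp only [h1]
  rw [integral_integral_swap (h.integrable_translate_kernel hρ)]
  refine integral_congr_ae (Eventually.of_forall fun ζ => ?_)
  simp only
  rw [integral_mul_const, mul_comm]

/-- For fixed `t`, Hölder and continuity of translations in `L^q` give convergence; the product of
the slice norms dominates in `t`. -/
theorem continuous_integral_translate (h : IsPaired ν p q a b) (hp : p ≠ ⊤) (hq : q ≠ ⊤) :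
    Continuous fun ζ => ∫ z, a z * b (z.1, z.2 + ζ) ∂(ν.prod volume) := by
  have hq1 : Fact (1 ≤ q) := ⟨ENNReal.HolderConjugate.one_le q p⟩
  simp only [fun ζ => integral_prod _ (h.integrable_translate ζ)]
  rw [continuous_iff_continuousAt]
  intro ζ₀
  have hint : ∀ᵐ t ∂ν, ∀ ζ : Rn n, Integrable (fun x => a (t, x) * b (t, x + ζ)) := by
    filter_upwards [h.left_slice, h.right_slice] with t ha hb ζ
    exact memLp_one_iff_integrable.1 (MemLp.mul (r := 1) (hb.comp_measurePreserving
      (measurePreserving_add_right volume ζ)) ha)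
  have hm := (aemeasurable_eLpNorm_slice h.left_meas (ENNReal.HolderConjugate.ne_zero p q) hp).mul
    (aemeasurable_eLpNorm_slice h.right_meas (ENNReal.HolderConjugate.ne_zero q p) hq)
  refine tendsto_integral_filter_of_dominated_convergence
    (fun t => (eLpNorm (fun x => a (t, x)) p volume *
      eLpNorm (fun x => b (t, x)) q volume).toReal)
    (Eventually.of_forall fun ζ => (h.integrable_translate ζ).integral_prod_left.1)
    (Eventually.of_forall fun ζ => ?_)
    (integrable_toReal_of_lintegral_ne_top hm h.lintegral_lt_top.ne) ?_
  · filter_upwards [h.left_slice, h.right_slice, h.lintegral_slice_le] with t ha hb ht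
    rw [← toReal_enorm]
    refine ENNReal.toReal_mono (ENNReal.mul_lt_top ha.2 hb.2).ne ?_
    refine (enorm_integral_le_lintegral_enorm _).trans ?_
    simpa only [enorm_mul] using ht ζ
  · filter_upwards [h.left_slice, h.right_slice, hint] with t ha hb hi
    rw [tendsto_iff_edist_tendsto_0]
    have h0 := ENNReal.Tendsto.const_mul (a := eLpNorm (fun x => a (t, x)) p volume)
      (tendsto_eLpNorm_translate_sub hq hb ζ₀) (Or.inr ha.2.ne)
    rw [mul_zero] at h0
    refine tendsto_of_tendsto_of_tendsto_of_le_of_le tendsto_const_nhds h0 (fun _ => zero_le)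
      fun ζ => ?_
    simp only
    rw [edist_eq_enorm_sub, ← integral_sub (hi ζ) (hi ζ₀)]
    refine (enorm_integral_le_lintegral_enorm _).trans ?_
    simp only [← mul_sub, enorm_mul]
    exact lintegral_enorm_mul_enorm_le ha.1 ((hb.1.comp_measurePreserving
      (measurePreserving_add_right volume ζ)).sub (hb.1.comp_measurePreserving
      (measurePreserving_add_right volume ζ₀)))

end IsPaired

end Pairing

/-! ### Mixed-norm spaces and continuity in time. -/

section Mixed

variable {n : ℕ} {T : ℝ} {p q r s : ℝ≥0∞} {f g : ℝ × Rn n → ℂ}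

theorem MemMixed.star (hf : MemMixed T r p f) :
    MemMixed T r p (fun z => starRingEnd ℂ (f z)) := by
  refine ⟨Complex.continuous_conj.comp_aestronglyMeasurable hf.1, ?_⟩
  have : ∀ t, eLpNorm (fun x : Rn n => starRingEnd ℂ (f (t, x))) p volume =
      eLpNorm (fun x : Rn n => f (t, x)) p volume := fun t =>
    eLpNorm_congr_norm_ae (Eventually.of_forall fun x => by simp)
  simpa only [mixedNorm, this] using hf.2

theorem MemContLp.star (hf : MemContLp T q f) :
    MemContLp T q (fun z => starRingEnd ℂ (f z)) := by
  refine ⟨Complex.continuous_conj.comp_aestronglyMeasurable hf.1,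
    fun t ht => ?_, fun t₀ ht₀ => ?_⟩
  · exact (hf.2.1 t ht).of_le
      (Complex.continuous_conj.comp_aestronglyMeasurable (hf.2.1 t ht).1)
      (Eventually.of_forall fun x => by simp)
  · have : ∀ t, eLpNorm (fun x : Rn n => starRingEnd ℂ (f (t, x)) - starRingEnd ℂ (f (t₀, x)))
        q volume = eLpNorm (fun x : Rn n => f (t, x) - f (t₀, x)) q volume := fun t =>
      eLpNorm_congr_norm_ae (Eventually.of_forall fun x => by rw [← map_sub, Complex.norm_conj])
    simpa only [this] using hf.2.2 t₀ ht₀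

theorem MemMixed.aestronglyMeasurable (hf : MemMixed T r p f) :
    AEStronglyMeasurable f (((volume : Measure ℝ).restrict (Ioo 0 T)).prod volume) := by
  rw [← volume_restrict_slab]
  exact hf.1

theorem MemContLp.aestronglyMeasurable (hf : MemContLp T q f) :
    AEStronglyMeasurable f (((volume : Measure ℝ).restrict (Ioo 0 T)).prod volume) := by
  rw [← volume_restrict_slab]
  exact hf.1

theorem MemMixed.lintegral_lt_top (hf : MemMixed T r p f) (hr : 1 ≤ r) (hp0 : p ≠ 0)
    (hp : p ≠ ⊤) : ∫⁻ t in Ioo 0 T, eLpNorm (fun x => f (t, x)) p volume < ⊤ := by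
  have : r.HolderConjugate r.conjExponent := .conjExponent hr
  have h1 : eLpNorm (fun _ : ℝ => (1 : ℝ≥0∞)) r.conjExponent
      ((volume : Measure ℝ).restrict (Ioo 0 T)) < ⊤ := (memLp_const_enorm (by simp)).2
  simpa using lintegral_mul_lt_top_of_eLpNorm (p := r) (q := r.conjExponent)
    (aemeasurable_eLpNorm_slice hf.aestronglyMeasurable hp0 hp)
    aemeasurable_const hf.2 h1

theorem MemMixed.ae_memLp (hf : MemMixed T r p f) (hr : 1 ≤ r) (hp0 : p ≠ 0) (hp : p ≠ ⊤) :
    ∀ᵐ t ∂((volume : Measure ℝ).restrict (Ioo 0 T)), MemLp (fun x => f (t, x)) p volume := by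
  filter_upwards [ae_aestronglyMeasurable_slice hf.aestronglyMeasurable,
    ae_lt_top' (aemeasurable_eLpNorm_slice hf.aestronglyMeasurable hp0 hp)
      (hf.lintegral_lt_top hr hp0 hp).ne] with t h1 h2 using ⟨h1, h2⟩

theorem MemMixed.isPaired [p.HolderConjugate q] [r.HolderConjugate s] (hf : MemMixed T r p f)
    (hg : MemMixed T s q g) (hp : p ≠ ⊤) (hq : q ≠ ⊤) :
    IsPaired ((volume : Measure ℝ).restrict (Ioo 0 T)) p q f g where
  left_meas := hf.aestronglyMeasurable
  right_meas := hg.aestronglyMeasurable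
  left_slice := hf.ae_memLp (ENNReal.HolderConjugate.one_le r s)
    (ENNReal.HolderConjugate.ne_zero p q) hp
  right_slice := hg.ae_memLp (ENNReal.HolderConjugate.one_le s r)
    (ENNReal.HolderConjugate.ne_zero q p) hq
  lintegral_lt_top := lintegral_mul_lt_top_of_eLpNorm (p := r) (q := s)
    (aemeasurable_eLpNorm_slice hf.aestronglyMeasurable (ENNReal.HolderConjugate.ne_zero p q) hp)
    (aemeasurable_eLpNorm_slice hg.aestronglyMeasurable (ENNReal.HolderConjugate.ne_zero q p) hq)
    hf.2 hg.2

/-- Near each `t₀` the norm exceeds its value at `t₀` by at most `1`; compactness of `[0,T]` makes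
the bound global. -/
theorem MemContLp.exists_eLpNorm_le (hf : MemContLp T q f) (hq : 1 ≤ q) :
    ∃ C : ℝ≥0∞, C ≠ ⊤ ∧ ∀ t ∈ Icc 0 T, eLpNorm (fun x => f (t, x)) q volume ≤ C := by
  refine isCompact_Icc.induction_on (p := fun S => ∃ C : ℝ≥0∞, C ≠ ⊤ ∧
    ∀ t ∈ S ∩ Icc 0 T, eLpNorm (fun x => f (t, x)) q volume ≤ C) ?_ ?_ ?_ ?_ |>.imp
      fun C hC => ⟨hC.1, fun t ht => hC.2 t ⟨ht, ht⟩⟩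
  · exact ⟨0, by simp, by simp⟩
  · rintro S S' hS ⟨C, hC, h⟩
    exact ⟨C, hC, fun t ht => h t ⟨hS ht.1, ht.2⟩⟩
  · rintro S S' ⟨C, hC, h⟩ ⟨C', hC', h'⟩
    refine ⟨max C C', by simp [hC, hC'], ?_⟩
    rintro t ⟨ht | ht, ht'⟩
    · exact (h t ⟨ht, ht'⟩).trans (le_max_left _ _)
    · exact (h' t ⟨ht, ht'⟩).trans (le_max_right _ _)
  · intro t₀ ht₀
    refine ⟨_, inter_mem self_mem_nhdsWithin ((hf.2.2 t₀ ht₀).eventually_lt_const zero_lt_one),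
      1 + eLpNorm (fun x => f (t₀, x)) q volume,
      ENNReal.add_ne_top.2 ⟨by simp, (hf.2.1 t₀ ht₀).2.ne⟩, ?_⟩
    rintro t ⟨⟨-, ht⟩, ht'⟩
    calc eLpNorm (fun x => f (t, x)) q volume
        = eLpNorm ((fun x => f (t, x) - f (t₀, x)) + fun x => f (t₀, x)) q volume := by
          congr 1; ext x; simp
      _ ≤ _ := eLpNorm_add_le ((hf.2.1 t ht').sub (hf.2.1 t₀ ht₀)).1 (hf.2.1 t₀ ht₀).1 hq
      _ ≤ _ := by gcongr; exact le_of_lt ht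

theorem MemContLp.memMixed_top (hf : MemContLp T q f) (hq : 1 ≤ q) : MemMixed T ⊤ q f := by
  obtain ⟨C, hC, h⟩ := hf.exists_eLpNorm_le hq
  refine ⟨hf.1, lt_of_le_of_lt ?_ hC.lt_top⟩
  rw [mixedNorm, eLpNorm_exponent_top]
  refine essSup_le_of_ae_le _ ?_
  filter_upwards [ae_restrict_mem measurableSet_Ioo] with t ht
  simpa using h t (Ioo_subset_Icc_self ht)

/-- The time interval is bounded, so the time exponent may be lowered to `1`, the one dual to the
`L^∞` in time available for continuous functions. -/
theorem MemMixed.exponent_one (hf : MemMixed T r p f) (hr : 1 ≤ r) (hp0 : p ≠ 0) (hp : p ≠ ⊤) :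
    MemMixed T 1 p f := by
  refine ⟨hf.1, ?_⟩
  rw [mixedNorm, eLpNorm_one_eq_lintegral_enorm]
  simpa using hf.lintegral_lt_top hr hp0 hp

theorem memMixed_top_indicator_closedBall (R : ℝ) :
    MemMixed T ⊤ q (fun z : ℝ × Rn n =>
      (Metric.closedBall (0 : Rn n) R).indicator (fun _ => (1 : ℂ)) z.2) := by
  have hm : MemLp ((Metric.closedBall (0 : Rn n) R).indicator fun _ => (1 : ℂ)) q volume :=
    memLp_indicator_const q Metric.isClosed_closedBall.measurableSet _
      (Or.inr (measure_closedBall_lt_top).ne)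
  refine ⟨?_, ?_⟩
  · have h : Measurable ((Metric.closedBall (0 : Rn n) R).indicator fun _ => (1 : ℂ)) :=
      measurable_const.indicator Metric.isClosed_closedBall.measurableSet
    exact (h.comp measurable_snd).aestronglyMeasurable
  · have h : eLpNorm (fun _ : ℝ => eLpNorm
        ((Metric.closedBall (0 : Rn n) R).indicator fun _ => (1 : ℂ)) q volume) ⊤
        ((volume : Measure ℝ).restrict (Ioo 0 T)) < ⊤ :=
      (memLp_const_enorm (by simpa using hm.2.ne)).2
    exact h

/-- Integrability over `(0,T)` times a ball, obtained by pairing with the indicator of the ball.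
This is all the integrability that doubling the variables requires. -/
theorem MemMixed.integrable_mul_indicator (hf : MemMixed T r p f) (hr : 1 ≤ r) (hp1 : 1 < p)
    (hp : p ≠ ⊤) (R : ℝ) :
    Integrable (fun z : ℝ × Rn n =>
        f z * (Metric.closedBall (0 : Rn n) R).indicator (fun _ => (1 : ℂ)) z.2)
      (((volume : Measure ℝ).restrict (Ioo 0 T)).prod volume) := by
  have h1 : p.HolderConjugate p.conjExponent := .conjExponent hp1.le
  have h2 : ENNReal.HolderConjugate 1 ⊤ := .one_top
  have h3 : p.conjExponent ≠ ⊤ := by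
    simpa [ENNReal.conjExponent, tsub_eq_zero_iff_le] using hp1
  exact ((hf.exponent_one hr (by positivity) hp).isPaired
    (memMixed_top_indicator_closedBall R) hp h3).integrable_mul

end Mixed

/-! ### Smoothing in space by compactly supported kernels. -/

/-- A bounded continuous kernel `κ x y` supported where `‖x‖ ≤ R` and `‖y‖ ≤ R`. -/
structure IsCutoffKernel {n : ℕ} (κ : Rn n → Rn n → ℝ) (R M : ℝ) : Prop where
  continuous : Continuous fun w : Rn n × Rn n => κ w.1 w.2
  left_mem : ∀ x y, κ x y ≠ 0 → x ∈ Metric.closedBall 0 R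
  right_mem : ∀ x y, κ x y ≠ 0 → y ∈ Metric.closedBall 0 R
  bound : ∀ x y, ‖κ x y‖ ≤ M

/-- The function `(t, x) ↦ ∫ B(t, y) κ(x, y) dy`. -/
noncomputable def kernelIntegral {n : ℕ} (κ : Rn n → Rn n → ℝ) (B : ℝ × Rn n → ℂ)
    (z : ℝ × Rn n) : ℂ :=
  ∫ y, B (z.1, y) * (κ z.2 y : ℂ)

theorem enorm_ofReal_complex (x : ℝ) : ‖(x : ℂ)‖ₑ = ‖x‖ₑ := by
  rw [← ofReal_norm, ← ofReal_norm, Complex.norm_real]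

namespace IsCutoffKernel

variable {n : ℕ} {κ : Rn n → Rn n → ℝ} {R M : ℝ}

theorem swap (h : IsCutoffKernel κ R M) : IsCutoffKernel (fun x y => κ y x) R M where
  continuous := h.continuous.comp continuous_swap
  left_mem x y := h.right_mem y x
  right_mem x y := h.left_mem y x
  bound x y := h.bound y x

theorem continuous_right (h : IsCutoffKernel κ R M) (x : Rn n) : Continuous (κ x) :=
  h.continuous.comp (by fun_prop : Continuous fun y => (x, y))

/-- Every `κ x ·` is dominated by `M` on one fixed ball, so Hölder gives a constant independent of
`x`: the conjugate norm of that majorant. -/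
theorem exists_lintegral_le (h : IsCutoffKernel κ R M) (q : ℝ≥0∞) (hq : 1 ≤ q) :
    ∃ A : ℝ≥0∞, A ≠ ⊤ ∧ ∀ (x : Rn n) (g : Rn n → ℂ), AEStronglyMeasurable g volume →
      ∫⁻ y, ‖g y‖ₑ * ‖κ x y‖ₑ ≤ eLpNorm g q volume * A := by
  have hq' : q.HolderConjugate q.conjExponent := .conjExponent hq
  have hm : MemLp ((Metric.closedBall (0 : Rn n) R).indicator fun _ => M) q.conjExponent volume :=
    memLp_indicator_const _ Metric.isClosed_closedBall.measurableSet _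
      (Or.inr (measure_closedBall_lt_top).ne)
  refine ⟨_, hm.2.ne, fun x g hg => ?_⟩
  have hκ : AEStronglyMeasurable (fun y => (κ x y : ℂ)) (volume : Measure (Rn n)) :=
    (Complex.continuous_ofReal.comp (h.continuous_right x)).aestronglyMeasurable
  have := lintegral_enorm_mul_enorm_le (p := q) (q := q.conjExponent) hg hκ
  simp only [enorm_ofReal_complex] at this
  refine this.trans ?_
  gcongr
  refine eLpNorm_mono fun y => ?_
  rw [Complex.norm_real]
  by_cases hy : y ∈ Metric.closedBall (0 : Rn n) R
  · simpa [indicator_of_mem hy] using (h.bound x y).trans (le_abs_self M)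
  · have : κ x y = 0 := by_contra fun h0 => hy (h.right_mem x y h0)
    simp [this]

theorem kernelIntegral_eq_zero (h : IsCutoffKernel κ R M) (B : ℝ × Rn n → ℂ) (z : ℝ × Rn n)
    (hz : z.2 ∉ Metric.closedBall (0 : Rn n) R) : kernelIntegral κ B z = 0 := by
  have : ∀ y, κ z.2 y = 0 := fun y => by_contra fun h0 => hz (h.left_mem _ _ h0)
  simp [kernelIntegral, this]

theorem exists_lintegral_slice_le (h : IsCutoffKernel κ R M) {T : ℝ} {q : ℝ≥0∞} (hq : 1 ≤ q)
    {B : ℝ × Rn n → ℂ} (hB : MemContLp T q B) :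
    ∃ C : ℝ≥0∞, C ≠ ⊤ ∧ ∀ s ∈ Icc 0 T, ∀ x, ∫⁻ y, ‖B (s, y)‖ₑ * ‖κ x y‖ₑ ≤ C := by
  obtain ⟨A, hA, hA'⟩ := h.exists_lintegral_le q hq
  obtain ⟨C, hC, hC'⟩ := hB.exists_eLpNorm_le hq
  refine ⟨C * A, ENNReal.mul_ne_top hC hA, fun s hs x => ?_⟩
  exact (hA' x _ (hB.2.1 s hs).1).trans (by gcongr; exact hC' s hs)

theorem exists_norm_kernelIntegral_le (h : IsCutoffKernel κ R M) {T : ℝ} {q : ℝ≥0∞} (hq : 1 ≤ q)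
    {B : ℝ × Rn n → ℂ} (hB : MemContLp T q B) :
    ∃ C : ℝ, 0 ≤ C ∧ ∀ s ∈ Icc 0 T, ∀ x, ‖kernelIntegral κ B (s, x)‖ ≤ C := by
  obtain ⟨C, hC, hC'⟩ := h.exists_lintegral_slice_le hq hB
  refine ⟨C.toReal, ENNReal.toReal_nonneg, fun s hs x => ?_⟩
  rw [← toReal_enorm]
  refine ENNReal.toReal_mono hC ((enorm_integral_le_lintegral_enorm _).trans ?_)
  simpa only [enorm_mul, enorm_ofReal_complex] using hC' s hs x

theorem integrable_mul (h : IsCutoffKernel κ R M) {q : ℝ≥0∞} (hq : 1 ≤ q) (x : Rn n)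
    {g : Rn n → ℂ} (hg : MemLp g q volume) : Integrable (fun y => g y * (κ x y : ℂ)) := by
  obtain ⟨A, hA, hA'⟩ := h.exists_lintegral_le q hq
  refine ⟨hg.1.mul (Complex.continuous_ofReal.comp (h.continuous_right x)).aestronglyMeasurable, ?_⟩
  simp only [HasFiniteIntegral, enorm_mul, enorm_ofReal_complex]
  exact (hA' x g hg.1).trans_lt (ENNReal.mul_lt_top hg.2 hA.lt_top)

/-- Spatial smoothing turns `L^q`-valued continuity into pointwise continuity in time, which is what
an approximate identity in time can be tested on. -/
theorem continuousOn_kernelIntegral (h : IsCutoffKernel κ R M) {T : ℝ} {q : ℝ≥0∞} (hq : 1 ≤ q)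
    {B : ℝ × Rn n → ℂ} (hB : MemContLp T q B) (x : Rn n) :
    ContinuousOn (fun s => kernelIntegral κ B (s, x)) (Icc 0 T) := by
  obtain ⟨A, hA, hA'⟩ := h.exists_lintegral_le q hq
  intro t₀ ht₀
  rw [ContinuousWithinAt, tendsto_iff_edist_tendsto_0]
  have h0 := ENNReal.Tendsto.mul_const (hB.2.2 t₀ ht₀) (b := A) (Or.inr hA)
  rw [zero_mul] at h0
  refine tendsto_of_tendsto_of_tendsto_of_le_of_le' tendsto_const_nhds h0
    (Eventually.of_forall fun _ => zero_le) ?_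
  filter_upwards [self_mem_nhdsWithin] with s hs
  rw [edist_eq_enorm_sub, kernelIntegral, kernelIntegral,
    ← integral_sub (h.integrable_mul hq x (hB.2.1 s hs)) (h.integrable_mul hq x (hB.2.1 t₀ ht₀))]
  refine (enorm_integral_le_lintegral_enorm _).trans ?_
  simp only [← sub_mul, enorm_mul, enorm_ofReal_complex]
  exact hA' x _ ((hB.2.1 s hs).sub (hB.2.1 t₀ ht₀)).1

end IsCutoffKernel

/-- Where `K` is nonzero both ball indicators equal `1`, so they can be inserted freely; the product
is then an integrable tensor product times a bounded kernel. -/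
theorem integrable_mul_mul_of_support {n : ℕ} {ν : Measure ℝ} [SFinite ν] {a b : ℝ × Rn n → ℂ}
    {R C : ℝ}
    (ha : Integrable (fun z : ℝ × Rn n =>
      a z * (Metric.closedBall (0 : Rn n) R).indicator (fun _ => (1 : ℂ)) z.2) (ν.prod volume))
    (hb : Integrable (fun z : ℝ × Rn n =>
      b z * (Metric.closedBall (0 : Rn n) R).indicator (fun _ => (1 : ℂ)) z.2) (ν.prod volume))
    {K : (ℝ × Rn n) × (ℝ × Rn n) → ℂ} (hK : Continuous K) (hC : ∀ w, ‖K w‖ ≤ C)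
    (h1 : ∀ w, K w ≠ 0 → w.1.2 ∈ Metric.closedBall 0 R)
    (h2 : ∀ w, K w ≠ 0 → w.2.2 ∈ Metric.closedBall 0 R) :
    Integrable (fun w => a w.1 * b w.2 * K w) ((ν.prod volume).prod (ν.prod volume)) := by
  refine ((ha.mul_prod hb).mul_bdd (c := C) hK.aestronglyMeasurable
    (Eventually.of_forall hC)).congr (Eventually.of_forall fun w => ?_)
  by_cases hw : K w = 0
  · simp [hw]
  · simp only [indicator_of_mem (h1 w hw), indicator_of_mem (h2 w hw), mul_one]

/-! ### Limits in time: the diagonal and the boundary. -/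

/-- A sequence of nonnegative continuous kernels in time that approximates the identity
on `(0, T)`. -/
structure IsTimeKernel (T : ℝ) (ψ : ℕ → ℝ → ℝ → ℝ) : Prop where
  continuous : ∀ m, Continuous fun w : ℝ × ℝ => ψ m w.1 w.2
  bounded : ∀ m, ∃ C, ∀ t s, ‖ψ m t s‖ ≤ C
  integral_le_one : ∀ m t, ∫⁻ s in Ioo 0 T, ‖ψ m t s‖ₑ ≤ 1
  tendsto : ∀ t ∈ Ioo 0 T, ∀ g : ℝ → ℂ, ContinuousOn g (Icc 0 T) →
    Tendsto (fun m => ∫ s in Ioo 0 T, (ψ m t s : ℂ) * g s) atTop (𝓝 (g t))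

section TimeLimit

variable {n : ℕ} {T R M : ℝ} {κ : Rn n → Rn n → ℝ} {q : ℝ≥0∞} {a B : ℝ × Rn n → ℂ}

theorem integral_time_kernel_eq (hκ : IsCutoffKernel κ R M)
    (hB : Integrable (fun z : ℝ × Rn n =>
        B z * (Metric.closedBall (0 : Rn n) R).indicator (fun _ => (1 : ℂ)) z.2)
      (((volume : Measure ℝ).restrict (Ioo 0 T)).prod volume))
    {θ : ℝ → ℝ} {C : ℝ} (hθ : Continuous θ) (hC : ∀ s, ‖θ s‖ ≤ C) (c : ℂ) (x : Rn n) :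
    ∫ w, c * B w * ((θ w.1 * κ x w.2 : ℝ) : ℂ)
        ∂(((volume : Measure ℝ).restrict (Ioo 0 T)).prod volume) =
      c * ∫ s in Ioo 0 T, (θ s : ℂ) * kernelIntegral κ B (s, x) := by
  have hint : Integrable (fun w : ℝ × Rn n => B w * ((θ w.1 * κ x w.2 : ℝ) : ℂ))
      (((volume : Measure ℝ).restrict (Ioo 0 T)).prod volume) := by
    have hcont : Continuous fun w : ℝ × Rn n => ((θ w.1 * κ x w.2 : ℝ) : ℂ) :=
      Complex.continuous_ofReal.comp ((hθ.comp continuous_fst).mul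
        ((hκ.continuous_right x).comp continuous_snd))
    refine (hB.mul_bdd (c := C * M) hcont.aestronglyMeasurable
      (Eventually.of_forall fun w => ?_)).congr (Eventually.of_forall fun w => ?_)
    · rw [Complex.norm_real, norm_mul]
      exact mul_le_mul (hC _) (hκ.bound _ _) (norm_nonneg _) ((norm_nonneg _).trans (hC 0))
    · by_cases hw : κ x w.2 = 0
      · simp [hw]
      · simp only [indicator_of_mem (hκ.right_mem _ _ hw), mul_one]
  simp only [mul_assoc c]
  rw [integral_const_mul, integral_prod _ hint]
  congr 1
  refine integral_congr_ae (Eventually.of_forall fun s => ?_)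
  simp only [kernelIntegral, ← integral_const_mul]
  congr 1
  ext y
  push_cast
  ring

/-- For fixed `(t,x)` the integral over `(s,y)` is `ψ m t` tested on the time-continuous function `s
↦ kernelIntegral κ B (s, x)`, hence converges pointwise. Mass at most `1` and the uniform bound on
`kernelIntegral` give a multiple of `|a|` on a ball as dominating function. -/
theorem tendsto_integral_timeKernel {ψ : ℕ → ℝ → ℝ → ℝ} (hψ : IsTimeKernel T ψ)
    (hκ : IsCutoffKernel κ R M) (hq : 1 ≤ q) (hB : MemContLp T q B)
    (ha : Integrable (fun z : ℝ × Rn n =>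
        a z * (Metric.closedBall (0 : Rn n) R).indicator (fun _ => (1 : ℂ)) z.2)
      (((volume : Measure ℝ).restrict (Ioo 0 T)).prod volume))
    (hB' : Integrable (fun z : ℝ × Rn n =>
        B z * (Metric.closedBall (0 : Rn n) R).indicator (fun _ => (1 : ℂ)) z.2)
      (((volume : Measure ℝ).restrict (Ioo 0 T)).prod volume)) :
    Tendsto (fun m => ∫ w, a w.1 * B w.2 * ((ψ m w.1.1 w.2.1 * κ w.1.2 w.2.2 : ℝ) : ℂ)
        ∂((((volume : Measure ℝ).restrict (Ioo 0 T)).prod volume).prod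
          (((volume : Measure ℝ).restrict (Ioo 0 T)).prod volume))) atTop
      (𝓝 (∫ z, a z * kernelIntegral κ B z
        ∂(((volume : Measure ℝ).restrict (Ioo 0 T)).prod volume))) := by
  have hint : ∀ m, Integrable (fun w : (ℝ × Rn n) × (ℝ × Rn n) =>
      a w.1 * B w.2 * ((ψ m w.1.1 w.2.1 * κ w.1.2 w.2.2 : ℝ) : ℂ))
      ((((volume : Measure ℝ).restrict (Ioo 0 T)).prod volume).prod
          (((volume : Measure ℝ).restrict (Ioo 0 T)).prod volume)) := by
    intro m
    obtain ⟨C, hC⟩ := hψ.bounded m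
    refine integrable_mul_mul_of_support (C := C * M) ha hB' ?_ ?_ ?_ ?_
    · exact Complex.continuous_ofReal.comp (((hψ.continuous m).comp
        (by fun_prop : Continuous fun w : (ℝ × Rn n) × (ℝ × Rn n) => (w.1.1, w.2.1))).mul
        (hκ.continuous.comp
        (by fun_prop : Continuous fun w : (ℝ × Rn n) × (ℝ × Rn n) => (w.1.2, w.2.2))))
    · intro w
      rw [Complex.norm_real, norm_mul]
      exact mul_le_mul (hC _ _) (hκ.bound _ _) (norm_nonneg _) ((norm_nonneg _).trans (hC 0 0))
    · exact fun w hw => hκ.left_mem _ w.2.2 fun h0 => hw (by simp [h0])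
    · exact fun w hw => hκ.right_mem w.1.2 _ fun h0 => hw (by simp [h0])
  have heq : ∀ m (z : ℝ × Rn n), ∫ w, a z * B w * ((ψ m z.1 w.1 * κ z.2 w.2 : ℝ) : ℂ)
        ∂(((volume : Measure ℝ).restrict (Ioo 0 T)).prod volume) =
      a z * ∫ s in Ioo 0 T, (ψ m z.1 s : ℂ) * kernelIntegral κ B (s, z.2) := by
    intro m z
    obtain ⟨C, hC⟩ := hψ.bounded m
    exact integral_time_kernel_eq hκ hB' ((hψ.continuous m).comp
      (by fun_prop : Continuous fun s : ℝ => (z.1, s))) (hC z.1) (a z) z.2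
  obtain ⟨C, hC0, hC⟩ := hκ.exists_norm_kernelIntegral_le hq hB
  simp only [fun m => integral_prod _ (hint m)]
  have hmem : ∀ᵐ z : ℝ × Rn n ∂(((volume : Measure ℝ).restrict (Ioo 0 T)).prod volume),
      z.1 ∈ Ioo 0 T :=
    Measure.quasiMeasurePreserving_fst.ae (ae_restrict_mem measurableSet_Ioo)
  refine tendsto_integral_filter_of_dominated_convergence
    (fun z => ‖a z * (Metric.closedBall (0 : Rn n) R).indicator (fun _ => (1 : ℂ)) z.2‖ * C)
    (Eventually.of_forall fun m => (hint m).integral_prod_left.1)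
    (Eventually.of_forall fun m => Eventually.of_forall fun z => ?_)
    (ha.norm.mul_const C) ?_
  · rw [heq]
    by_cases hz : z.2 ∈ Metric.closedBall (0 : Rn n) R
    · rw [indicator_of_mem hz, mul_one, norm_mul]
      gcongr
      rw [← toReal_enorm]
      refine ENNReal.toReal_le_of_le_ofReal hC0 ?_
      calc ‖∫ s in Ioo 0 T, (ψ m z.1 s : ℂ) * kernelIntegral κ B (s, z.2)‖ₑ
          ≤ ∫⁻ s in Ioo 0 T, ‖(ψ m z.1 s : ℂ) * kernelIntegral κ B (s, z.2)‖ₑ :=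
            enorm_integral_le_lintegral_enorm _
        _ ≤ ∫⁻ s in Ioo 0 T, ‖ψ m z.1 s‖ₑ * ENNReal.ofReal C := by
            refine setLIntegral_mono_ae' measurableSet_Ioo (Eventually.of_forall fun s hs => ?_)
            rw [enorm_mul, enorm_ofReal_complex, ← ofReal_norm (kernelIntegral κ B (s, z.2))]
            gcongr
            exact hC s (Ioo_subset_Icc_self hs) z.2
        _ = (∫⁻ s in Ioo 0 T, ‖ψ m z.1 s‖ₑ) * ENNReal.ofReal C :=
            lintegral_mul_const' _ _ ENNReal.ofReal_ne_top
        _ ≤ 1 * ENNReal.ofReal C := by gcongr; exact hψ.integral_le_one m z.1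
        _ = _ := one_mul _
    · have : ∀ s, kernelIntegral κ B (s, z.2) = 0 := fun s => hκ.kernelIntegral_eq_zero B _ hz
      simp [this, hz]
  · filter_upwards [hmem] with z hz
    simp only [heq]
    exact (hψ.tendsto z.1 hz _ (hκ.continuousOn_kernelIntegral hq hB z.2)).const_mul _

theorem MemContLp.exists_eLpNorm_le_near (ha : MemContLp T q a) {t₀ : ℝ} (ht₀ : t₀ ∈ Icc 0 T)
    (h0 : (fun x : Rn n => a (t₀, x)) =ᵐ[volume] 0) {ε : ℝ≥0∞} (hε : 0 < ε) :
    ∃ δ > 0, ∀ t ∈ Icc 0 T, |t - t₀| < δ → eLpNorm (fun x => a (t, x)) q volume ≤ ε := by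
  have h := (ha.2.2 t₀ ht₀).eventually_le_const hε
  rw [eventually_nhdsWithin_iff, Metric.eventually_nhds_iff] at h
  obtain ⟨δ, hδ, h⟩ := h
  refine ⟨δ, hδ, fun t ht htδ => ?_⟩
  refine (eLpNorm_congr_ae ?_).trans_le (h (by rwa [Real.dist_eq]) ht)
  filter_upwards [h0] with x hx
  simp only [Pi.zero_apply] at hx
  rw [hx, sub_zero]

/-- The weights have bounded mass and eventually live only near `0` and `T`, where the norm of
`a(t,·)` is small by continuity. -/
theorem tendsto_lintegral_boundary {k : ℕ → ℝ → ℝ} {D : ℝ≥0∞} (hD : D ≠ ⊤)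
    (hkD : ∀ m, ∫⁻ t in Ioo 0 T, ‖k m t‖ₑ ≤ D)
    (hk0 : ∀ δ > 0, ∀ᶠ m in atTop, ∀ t ∈ Icc δ (T - δ), k m t = 0)
    (ha : MemContLp T q a)
    (ha0 : (fun x : Rn n => a (0, x)) =ᵐ[volume] 0)
    (haT : (fun x : Rn n => a (T, x)) =ᵐ[volume] 0) (hT : 0 < T) :
    Tendsto (fun m => ∫⁻ t in Ioo 0 T, ‖k m t‖ₑ * eLpNorm (fun x => a (t, x)) q volume) atTop
      (𝓝 0) := by
  have key : ∀ ε : ℝ≥0∞, 0 < ε → ε ≠ ⊤ → ∀ᶠ m in atTop,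
      ∫⁻ t in Ioo 0 T, ‖k m t‖ₑ * eLpNorm (fun x => a (t, x)) q volume ≤ D * ε := by
    intro ε hε hε'
    obtain ⟨δ₁, hδ₁, h₁⟩ := ha.exists_eLpNorm_le_near (left_mem_Icc.2 hT.le) ha0 hε
    obtain ⟨δ₂, hδ₂, h₂⟩ := ha.exists_eLpNorm_le_near (right_mem_Icc.2 hT.le) haT hε
    filter_upwards [hk0 (min δ₁ δ₂) (lt_min hδ₁ hδ₂)] with m hm
    calc ∫⁻ t in Ioo 0 T, ‖k m t‖ₑ * eLpNorm (fun x => a (t, x)) q volume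
        ≤ ∫⁻ t in Ioo 0 T, ‖k m t‖ₑ * ε := by
          refine setLIntegral_mono_ae' measurableSet_Ioo (Eventually.of_forall fun t ht => ?_)
          by_cases ht' : t ∈ Icc (min δ₁ δ₂) (T - min δ₁ δ₂)
          · simp [hm t ht']
          · gcongr
            rw [mem_Icc, not_and_or, not_le, not_le] at ht'
            rcases ht' with ht' | ht'
            · refine h₁ t (Ioo_subset_Icc_self ht) ?_
              rw [sub_zero, abs_of_pos ht.1]
              exact ht'.trans_le (min_le_left _ _)
            · refine h₂ t (Ioo_subset_Icc_self ht) ?_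
              rw [abs_sub_comm, abs_of_pos (sub_pos.2 ht.2)]
              linarith [min_le_right δ₁ δ₂]
      _ = (∫⁻ t in Ioo 0 T, ‖k m t‖ₑ) * ε := lintegral_mul_const' _ _ hε'
      _ ≤ D * ε := by gcongr; exact hkD m
  rw [ENNReal.tendsto_nhds_zero]
  intro ε hε
  rcases eq_or_ne ε ⊤ with rfl | hε'
  · simp
  · have hD1 : D + 1 ≠ ⊤ := by simp [hD]
    -- Dividing by `D + 1` rather than `D` covers the case `D = 0`.
    filter_upwards [key (ε / (D + 1)) (ENNReal.div_pos hε.ne' hD1)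
      (ENNReal.div_ne_top hε' (by simp))] with m hm
    refine hm.trans ?_
    calc D * (ε / (D + 1)) ≤ (D + 1) * (ε / (D + 1)) := by gcongr; exact le_self_add
      _ = ε := ENNReal.mul_div_cancel (by simp) hD1

/-- The integral over `(s,y)` is bounded uniformly and vanishes for `x` off a ball; Hölder on that
ball reduces the rest to `∫ |k m t| ‖a(t,·)‖ dt`. Only the mass bound on `ψ` matters here, not its
convergence. -/
theorem tendsto_integral_boundary {k : ℕ → ℝ → ℝ} {ψ : ℕ → ℝ → ℝ → ℝ}
    (hψc : ∀ m, Continuous fun w : ℝ × ℝ => ψ m w.1 w.2)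
    (hψ : ∀ m t, ∫⁻ s in Ioo 0 T, ‖ψ m t s‖ₑ ≤ 1)
    (hk : ∀ m, Continuous (k m)) {D : ℝ≥0∞} (hD : D ≠ ⊤)
    (hkD : ∀ m, ∫⁻ t in Ioo 0 T, ‖k m t‖ₑ ≤ D)
    (hk0 : ∀ δ > 0, ∀ᶠ m in atTop, ∀ t ∈ Icc δ (T - δ), k m t = 0)
    (hκ : IsCutoffKernel κ R M) (hq : 1 ≤ q) (hB : MemContLp T q B)
    {q' : ℝ≥0∞} (hq' : 1 ≤ q') (ha : MemContLp T q' a)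
    (ha0 : (fun x : Rn n => a (0, x)) =ᵐ[volume] 0)
    (haT : (fun x : Rn n => a (T, x)) =ᵐ[volume] 0) (hT : 0 < T) :
    Tendsto (fun m => ∫ w, a w.1 * B w.2 * ((k m w.1.1 * ψ m w.1.1 w.2.1 * κ w.1.2 w.2.2 : ℝ) : ℂ)
        ∂((((volume : Measure ℝ).restrict (Ioo 0 T)).prod volume).prod
          (((volume : Measure ℝ).restrict (Ioo 0 T)).prod volume))) atTop (𝓝 0) := by
  obtain ⟨C, hC, hC'⟩ := hκ.exists_lintegral_slice_le hq hB
  have hconj : q'.HolderConjugate q'.conjExponent := .conjExponent hq'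
  have hm : MemLp ((Metric.closedBall (0 : Rn n) R).indicator fun _ => (1 : ℂ))
      q'.conjExponent volume :=
    memLp_indicator_const _ Metric.isClosed_closedBall.measurableSet _
      (Or.inr (measure_closedBall_lt_top).ne)
  set A := eLpNorm ((Metric.closedBall (0 : Rn n) R).indicator fun _ => (1 : ℂ))
      q'.conjExponent volume
  set μ := ((volume : Measure ℝ).restrict (Ioo 0 T)).prod (volume : Measure (Rn n)) with hμ
  have hκm : Measurable fun w : Rn n × Rn n => κ w.1 w.2 := hκ.continuous.measurable
  have hψm : ∀ m, Measurable fun w : ℝ × ℝ => ψ m w.1 w.2 := fun m => (hψc m).measurable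
  have hkm : ∀ m, Measurable (k m) := fun m => (hk m).measurable
  have inner : ∀ m, ∀ z : ℝ × Rn n,
      ∫⁻ w, ‖B w‖ₑ * (‖ψ m z.1 w.1‖ₑ * ‖κ z.2 w.2‖ₑ) ∂μ ≤
        C * ‖(Metric.closedBall (0 : Rn n) R).indicator (fun _ => (1 : ℂ)) z.2‖ₑ := by
    intro m z
    by_cases hz : z.2 ∈ Metric.closedBall (0 : Rn n) R
    · have hmeas : AEMeasurable (fun w : ℝ × Rn n =>
          ‖B w‖ₑ * (‖ψ m z.1 w.1‖ₑ * ‖κ z.2 w.2‖ₑ)) μ :=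
        hB.aestronglyMeasurable.enorm.mul (Measurable.aemeasurable (by fun_prop))
      rw [lintegral_prod _ hmeas, indicator_of_mem hz, enorm_one, mul_one]
      calc ∫⁻ s in Ioo 0 T, ∫⁻ y, ‖B (s, y)‖ₑ * (‖ψ m z.1 s‖ₑ * ‖κ z.2 y‖ₑ)
          ≤ ∫⁻ s in Ioo 0 T, ‖ψ m z.1 s‖ₑ * C := by
            refine setLIntegral_mono_ae' measurableSet_Ioo (Eventually.of_forall fun s hs => ?_)
            simp only [mul_left_comm _ ‖ψ m z.1 s‖ₑ]
            rw [lintegral_const_mul' _ _ enorm_ne_top]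
            gcongr
            exact hC' s (Ioo_subset_Icc_self hs) z.2
        _ = (∫⁻ s in Ioo 0 T, ‖ψ m z.1 s‖ₑ) * C := lintegral_mul_const' _ _ hC
        _ ≤ 1 * C := by gcongr; exact hψ m z.1
        _ = C := one_mul C
    · have : ∀ y, κ z.2 y = 0 := fun y => by_contra fun h0 => hz (hκ.left_mem _ _ h0)
      simp [this]
  have bound : ∀ m, ‖∫ w, a w.1 * B w.2 *
      ((k m w.1.1 * ψ m w.1.1 w.2.1 * κ w.1.2 w.2.2 : ℝ) : ℂ) ∂(μ.prod μ)‖ₑ ≤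
      (C * A) * ∫⁻ t in Ioo 0 T, ‖k m t‖ₑ * eLpNorm (fun x => a (t, x)) q' volume := by
    intro m
    have hmeas : AEMeasurable (fun w : (ℝ × Rn n) × (ℝ × Rn n) => ‖a w.1‖ₑ * ‖k m w.1.1‖ₑ *
        (‖B w.2‖ₑ * (‖ψ m w.1.1 w.2.1‖ₑ * ‖κ w.1.2 w.2.2‖ₑ))) (μ.prod μ) := by
      refine (ha.aestronglyMeasurable.comp_fst.enorm.mul
        (Measurable.aemeasurable (by fun_prop))).mul
        (hB.aestronglyMeasurable.comp_snd.enorm.mul (Measurable.aemeasurable (by fun_prop)))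
    have hmeas2 : AEMeasurable (fun z : ℝ × Rn n => ‖a z‖ₑ * ‖k m z.1‖ₑ *
        (C * ‖(Metric.closedBall (0 : Rn n) R).indicator (fun _ => (1 : ℂ)) z.2‖ₑ)) μ := by
      refine (ha.aestronglyMeasurable.enorm.mul (Measurable.aemeasurable (by fun_prop))).mul
        (Measurable.aemeasurable ?_)
      have hind : Measurable ((Metric.closedBall (0 : Rn n) R).indicator fun _ => (1 : ℂ)) :=
        measurable_const.indicator Metric.isClosed_closedBall.measurableSet
      exact (hind.comp measurable_snd).enorm.const_mul C
    calc _ ≤ ∫⁻ w, ‖a w.1 * B w.2 *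
          ((k m w.1.1 * ψ m w.1.1 w.2.1 * κ w.1.2 w.2.2 : ℝ) : ℂ)‖ₑ ∂(μ.prod μ) :=
          enorm_integral_le_lintegral_enorm _
      _ = ∫⁻ w, ‖a w.1‖ₑ * ‖k m w.1.1‖ₑ *
          (‖B w.2‖ₑ * (‖ψ m w.1.1 w.2.1‖ₑ * ‖κ w.1.2 w.2.2‖ₑ)) ∂(μ.prod μ) := by
          refine lintegral_congr fun w => ?_
          rw [enorm_mul, enorm_mul, enorm_ofReal_complex, enorm_mul, enorm_mul]
          ring
      _ = ∫⁻ z, ‖a z‖ₑ * ‖k m z.1‖ₑ *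
          ∫⁻ w, ‖B w‖ₑ * (‖ψ m z.1 w.1‖ₑ * ‖κ z.2 w.2‖ₑ) ∂μ ∂μ := by
          rw [lintegral_prod _ hmeas]
          refine lintegral_congr fun z => ?_
          exact lintegral_const_mul' (‖a z‖ₑ * ‖k m z.1‖ₑ) _
            (ENNReal.mul_ne_top enorm_ne_top enorm_ne_top)
      _ ≤ ∫⁻ z, ‖a z‖ₑ * ‖k m z.1‖ₑ *
          (C * ‖(Metric.closedBall (0 : Rn n) R).indicator (fun _ => (1 : ℂ)) z.2‖ₑ) ∂μ := by
          exact lintegral_mono fun z => mul_le_mul_right (inner m z) _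
      _ = ∫⁻ t in Ioo 0 T, (C * ‖k m t‖ₑ) * ∫⁻ x, ‖a (t, x)‖ₑ *
          ‖(Metric.closedBall (0 : Rn n) R).indicator (fun _ => (1 : ℂ)) x‖ₑ := by
          rw [lintegral_prod _ hmeas2]
          refine lintegral_congr fun t => ?_
          rw [← lintegral_const_mul' _ _ (ENNReal.mul_ne_top hC enorm_ne_top)]
          refine lintegral_congr fun x => ?_
          ring
      _ ≤ ∫⁻ t in Ioo 0 T, (C * A) * (‖k m t‖ₑ * eLpNorm (fun x => a (t, x)) q' volume) := by
          refine setLIntegral_mono_ae' measurableSet_Ioo (Eventually.of_forall fun t ht => ?_)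
          calc _ ≤ (C * ‖k m t‖ₑ) * (eLpNorm (fun x => a (t, x)) q' volume * A) := by
                gcongr
                exact lintegral_enorm_mul_enorm_le (ha.2.1 t (Ioo_subset_Icc_self ht)).1 hm.1
            _ = _ := by ring
      _ = _ := lintegral_const_mul' _ _ (ENNReal.mul_ne_top hC hm.2.ne)
  have h0 := ENNReal.Tendsto.const_mul (tendsto_lintegral_boundary hD hkD hk0 ha ha0 haT hT)
    (a := C * A) (Or.inr (ENNReal.mul_ne_top hC hm.2.ne))
  rw [mul_zero] at h0
  rw [tendsto_iff_edist_tendsto_0]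
  simp only [edist_zero_right]
  exact tendsto_of_tendsto_of_tendsto_of_le_of_le tendsto_const_nhds h0 (fun _ => zero_le) bound

end TimeLimit

/-! ### Explicit cutoffs and mollifiers in time. -/

open Real (smoothTransition)

/-- Such a point is a global minimum, which also handles the endpoint `0` without one-sided
derivatives. -/
theorem deriv_smoothTransition_of_nonpos {x : ℝ} (hx : x ≤ 0) : deriv smoothTransition x = 0 := by
  refine IsLocalMin.deriv_eq_zero (Eventually.of_forall fun y => ?_)
  rw [smoothTransition.zero_of_nonpos hx]
  exact smoothTransition.nonneg y

theorem deriv_smoothTransition_of_one_le {x : ℝ} (hx : 1 ≤ x) : deriv smoothTransition x = 0 := by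
  refine IsLocalMax.deriv_eq_zero (Eventually.of_forall fun y => ?_)
  rw [smoothTransition.one_of_one_le hx]
  exact smoothTransition.le_one y

theorem exists_norm_deriv_smoothTransition_le : ∃ C, ∀ x, ‖deriv smoothTransition x‖ ≤ C := by
  refine Continuous.bounded_above_of_compact_support
    ((smoothTransition.contDiff (n := 1)).continuous_deriv le_rfl)
    (HasCompactSupport.intro (isCompact_Icc (a := (0 : ℝ)) (b := 1)) fun x hx => ?_)
  rw [mem_Icc, not_and_or, not_le, not_le] at hx
  exact hx.elim (fun h => deriv_smoothTransition_of_nonpos h.le)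
    fun h => deriv_smoothTransition_of_one_le h.le

/-- A smooth cutoff equal to `1` on `[2δ, T - 2δ]` and supported in `[δ, T - δ]`. -/
noncomputable def timeCutoff (T δ t : ℝ) : ℝ :=
  smoothTransition (t / δ - 1) * smoothTransition ((T - t) / δ - 1)

section timeCutoff

variable {T δ t : ℝ}

theorem contDiff_timeCutoff {k : ℕ∞} : ContDiff ℝ k (timeCutoff T δ) :=
  (smoothTransition.contDiff.comp (by fun_prop)).mul (smoothTransition.contDiff.comp (by fun_prop))

theorem timeCutoff_nonneg : 0 ≤ timeCutoff T δ t :=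
  mul_nonneg (smoothTransition.nonneg _) (smoothTransition.nonneg _)

theorem timeCutoff_le_one : timeCutoff T δ t ≤ 1 :=
  mul_le_one₀ (smoothTransition.le_one _) (smoothTransition.nonneg _) (smoothTransition.le_one _)

theorem timeCutoff_eq_one (hδ : 0 < δ) (h1 : 2 * δ ≤ t) (h2 : t ≤ T - 2 * δ) :
    timeCutoff T δ t = 1 := by
  rw [timeCutoff, smoothTransition.one_of_one_le, smoothTransition.one_of_one_le, one_mul]
  · rw [le_sub_iff_add_le, le_div_iff₀ hδ]; linarith
  · rw [le_sub_iff_add_le, le_div_iff₀ hδ]; linarith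

theorem mem_of_timeCutoff_ne_zero (hδ : 0 < δ) (h : timeCutoff T δ t ≠ 0) :
    t ∈ Icc δ (T - δ) := by
  by_contra hn
  rw [mem_Icc, not_and_or, not_le, not_le] at hn
  refine h ?_
  rcases hn with hn | hn
  · rw [timeCutoff, smoothTransition.zero_of_nonpos, zero_mul]
    rw [sub_nonpos, div_le_one hδ]; exact hn.le
  · rw [timeCutoff, smoothTransition.zero_of_nonpos (x := (T - t) / δ - 1), mul_zero]
    rw [sub_nonpos, div_le_one hδ]; linarith

theorem deriv_timeCutoff : deriv (timeCutoff T δ) t =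
    δ⁻¹ * deriv smoothTransition (t / δ - 1) * smoothTransition ((T - t) / δ - 1) -
      smoothTransition (t / δ - 1) * (δ⁻¹ * deriv smoothTransition ((T - t) / δ - 1)) := by
  have hS : ∀ x, HasDerivAt smoothTransition (deriv smoothTransition x) x := fun x =>
    ((smoothTransition.contDiff (n := 1)).differentiable one_ne_zero x).hasDerivAt
  have h1 : HasDerivAt (fun t => t / δ - 1) δ⁻¹ t := by
    simpa using ((hasDerivAt_id t).div_const δ).sub_const 1
  have h2 : HasDerivAt (fun t => (T - t) / δ - 1) (-δ⁻¹) t := by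
    simpa [neg_div] using (((hasDerivAt_id t).const_sub T).div_const δ).sub_const 1
  have := ((hS _).comp t h1).mul ((hS _).comp t h2)
  refine (this.deriv).trans ?_
  simp only [Function.comp]
  ring

theorem deriv_timeCutoff_eq_zero (hδ : 0 < δ) (h1 : 2 * δ ≤ t) (h2 : t ≤ T - 2 * δ) :
    deriv (timeCutoff T δ) t = 0 := by
  rw [deriv_timeCutoff, deriv_smoothTransition_of_one_le, deriv_smoothTransition_of_one_le]
  · simp
  · rw [le_sub_iff_add_le, le_div_iff₀ hδ]; linarith
  · rw [le_sub_iff_add_le, le_div_iff₀ hδ]; linarith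

/-- The derivative is `O(1/δ)` and, within `(0,T)`, lives on two intervals of length `2δ`, so its
mass does not depend on `δ`. -/
theorem exists_lintegral_deriv_timeCutoff_le : ∃ D : ℝ≥0∞, D ≠ ⊤ ∧ ∀ T δ : ℝ, 0 < δ →
    ∫⁻ t in Ioo 0 T, ‖deriv (timeCutoff T δ) t‖ₑ ≤ D := by
  obtain ⟨C, hC⟩ := exists_norm_deriv_smoothTransition_le
  have hC0 : 0 ≤ C := (norm_nonneg _).trans (hC 0)
  refine ⟨ENNReal.ofReal (8 * C), ENNReal.ofReal_ne_top, fun T δ hδ => ?_⟩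
  have hb : ∀ t, ‖deriv (timeCutoff T δ) t‖ ≤ δ⁻¹ * (2 * C) := by
    intro t
    have hn : ∀ x, ‖smoothTransition x‖ ≤ 1 := fun x => by
      rw [Real.norm_of_nonneg (smoothTransition.nonneg x)]; exact smoothTransition.le_one x
    have hδ' : ‖δ⁻¹‖ = δ⁻¹ := Real.norm_of_nonneg (inv_nonneg.2 hδ.le)
    rw [deriv_timeCutoff]
    refine (norm_sub_le _ _).trans ?_
    rw [norm_mul, norm_mul, norm_mul, norm_mul, hδ']
    have h1 : δ⁻¹ * ‖deriv smoothTransition (t / δ - 1)‖ * ‖smoothTransition ((T - t) / δ - 1)‖ ≤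
        δ⁻¹ * C * 1 := by
      gcongr
      exacts [hC _, hn _]
    have h2 : ‖smoothTransition (t / δ - 1)‖ * (δ⁻¹ * ‖deriv smoothTransition ((T - t) / δ - 1)‖) ≤
        1 * (δ⁻¹ * C) := by
      gcongr
      exacts [hn _, hC _]
    linarith
  calc ∫⁻ t in Ioo 0 T, ‖deriv (timeCutoff T δ) t‖ₑ
      ≤ ∫⁻ t in Ioo 0 T, (Icc 0 (2 * δ) ∪ Icc (T - 2 * δ) T).indicator
          (fun _ => ENNReal.ofReal (δ⁻¹ * (2 * C))) t := by
        refine setLIntegral_mono_ae' measurableSet_Ioo (Eventually.of_forall fun t ht => ?_)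
        by_cases h : t ∈ Icc 0 (2 * δ) ∪ Icc (T - 2 * δ) T
        · rw [indicator_of_mem h, ← ofReal_norm]
          exact ENNReal.ofReal_le_ofReal (hb t)
        · rw [indicator_of_notMem h, deriv_timeCutoff_eq_zero hδ]
          · simp
          · by_contra! h'
            exact h (Or.inl ⟨ht.1.le, h'.le⟩)
          · by_contra! h'
            exact h (Or.inr ⟨h'.le, ht.2.le⟩)
    _ ≤ ∫⁻ t, (Icc 0 (2 * δ) ∪ Icc (T - 2 * δ) T).indicator
          (fun _ => ENNReal.ofReal (δ⁻¹ * (2 * C))) t := setLIntegral_le_lintegral _ _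
    _ = ENNReal.ofReal (δ⁻¹ * (2 * C)) * volume (Icc 0 (2 * δ) ∪ Icc (T - 2 * δ) T) := by
        rw [lintegral_indicator_const (measurableSet_Icc.union measurableSet_Icc)]
    _ ≤ ENNReal.ofReal (δ⁻¹ * (2 * C)) * ENNReal.ofReal (4 * δ) := by
        gcongr
        refine (measure_union_le _ _).trans ?_
        rw [Real.volume_Icc, Real.volume_Icc, ← ENNReal.ofReal_add (by linarith) (by linarith)]
        exact ENNReal.ofReal_le_ofReal (by linarith)
    _ = ENNReal.ofReal (8 * C) := by
        rw [← ENNReal.ofReal_mul (by positivity)]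
        congr 1
        field_simp
        ring

end timeCutoff

/-- The scale `1 / (m + 1)`. -/
noncomputable def timeScale (m : ℕ) : ℝ := 1 / ((m : ℝ) + 1)

theorem timeScale_pos (m : ℕ) : 0 < timeScale m := Nat.one_div_pos_of_nat

theorem tendsto_timeScale : Tendsto timeScale atTop (𝓝 0) :=
  tendsto_one_div_add_atTop_nhds_zero_nat

/-- A bump function on `ℝ` supported in `[-timeScale m / 2, timeScale m / 2]`. -/
noncomputable def timeBump (m : ℕ) : ContDiffBump (0 : ℝ) where
  rIn := timeScale m / 4
  -- Half the cutoff scale `δ`: if `t ∈ [δ, T - δ]` and `|t - s| < δ/2`, then `s` stays in `[δ/2, T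
  -- - δ/2]`, so the kernel is also an admissible test function in `s`.
  rOut := timeScale m / 2
  rIn_pos := by have := timeScale_pos m; positivity
  rIn_lt_rOut := by have := timeScale_pos m; linarith

/-- A normalised mollifier in time. -/
noncomputable def timeMollifier (m : ℕ) : ℝ → ℝ := (timeBump m).normed volume

theorem abs_le_of_timeMollifier_ne_zero {m : ℕ} {t : ℝ} (h : timeMollifier m t ≠ 0) :
    |t| < timeScale m / 2 := by
  have : t ∈ Function.support ((timeBump m).normed volume) := h
  rw [ContDiffBump.support_normed_eq] at this
  simpa [timeBump] using this

theorem timeMollifier_nonneg (m : ℕ) (t : ℝ) : 0 ≤ timeMollifier m t :=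
  (timeBump m).nonneg_normed t

theorem continuous_timeMollifier (m : ℕ) : Continuous (timeMollifier m) :=
  (timeBump m).continuous_normed

theorem lintegral_timeMollifier (m : ℕ) (t : ℝ) : ∫⁻ s, ‖timeMollifier m (t - s)‖ₑ = 1 := by
  rw [lintegral_sub_left_eq_self (fun s => ‖timeMollifier m s‖ₑ) t]
  have h1 : ∫ s, timeMollifier m s = 1 := (timeBump m).integral_normed
  have h2 := ofReal_integral_eq_lintegral_ofReal (f := timeMollifier m) (μ := volume)
    (timeBump m).integrable_normed (Eventually.of_forall (timeMollifier_nonneg m))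
  rw [h1, ENNReal.ofReal_one] at h2
  rw [h2]
  refine lintegral_congr fun s => ?_
  rw [← ofReal_norm, Real.norm_of_nonneg (timeMollifier_nonneg m s)]

/-- After extending `g` by zero outside `(0,T)`, only continuity at the interior point `t` matters.
-/
theorem tendsto_integral_timeMollifier {T t : ℝ} (ht : t ∈ Ioo 0 T) {g : ℝ → ℂ}
    (hg : ContinuousOn g (Icc 0 T)) :
    Tendsto (fun m => ∫ s in Ioo 0 T, (timeMollifier m (t - s) : ℂ) * g s) atTop (𝓝 (g t)) := by
  have hmeas : AEStronglyMeasurable ((Ioo 0 T).indicator g) volume :=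
    (aestronglyMeasurable_indicator_iff measurableSet_Ioo).2
      ((hg.mono Ioo_subset_Icc_self).aestronglyMeasurable measurableSet_Ioo)
  have hcont : ContinuousAt ((Ioo 0 T).indicator g) t := by
    refine ((hg.mono Ioo_subset_Icc_self).continuousAt (Ioo_mem_nhds ht.1 ht.2)).congr ?_
    filter_upwards [Ioo_mem_nhds ht.1 ht.2] with s hs
    rw [indicator_of_mem hs]
  have h0 : Tendsto (fun m => (timeBump m).rOut) atTop (𝓝 0) := by
    simpa [timeBump] using tendsto_timeScale.div_const 2
  have h := ContDiffBump.convolution_tendsto_right (μ := volume) (φ := timeBump)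
    (g := fun _ => (Ioo 0 T).indicator g) (k := fun _ => t) (x₀ := t) h0
    (Eventually.of_forall fun _ => hmeas) (hcont.tendsto.comp tendsto_snd) tendsto_const_nhds
  rw [indicator_of_mem ht] at h
  refine h.congr fun m => ?_
  rw [convolution_lsmul_swap, ← integral_indicator measurableSet_Ioo]
  refine integral_congr_ae (Eventually.of_forall fun s => ?_)
  by_cases hs : s ∈ Ioo 0 T
  · simp [hs, timeMollifier]
  · simp [hs]

/-- A factor between `0` and `1` keeps the mass at most `1`, and once it equals `1` within reach of
the mollifier it no longer affects the limit. Leaving the argument of the cutoff free serves both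
orders of integration. -/
theorem isTimeKernel_of_eventually {T : ℝ} {c : ℕ → ℝ → ℝ → ℝ}
    (hc : ∀ m, Continuous fun w : ℝ × ℝ => c m w.1 w.2)
    (hc0 : ∀ m t s, 0 ≤ c m t s) (hc1 : ∀ m t s, c m t s ≤ 1)
    (h : ∀ t ∈ Ioo 0 T, ∀ᶠ m in atTop, ∀ s, |t - s| < timeScale m / 2 → c m t s = 1) :
    IsTimeKernel T fun m t s => c m t s * timeMollifier m (t - s) where
  continuous m := (hc m).mul ((continuous_timeMollifier m).comp (by fun_prop))
  bounded m := by
    obtain ⟨C, hC⟩ := (continuous_timeMollifier m).bounded_above_of_compact_support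
      (timeBump m).hasCompactSupport_normed
    refine ⟨C, fun t s => ?_⟩
    rw [norm_mul, Real.norm_of_nonneg (hc0 m t s)]
    exact (mul_le_of_le_one_left (norm_nonneg _) (hc1 m t s)).trans (hC _)
  integral_le_one m t := by
    refine (setLIntegral_le_lintegral _ _).trans ?_
    rw [← lintegral_timeMollifier m t]
    refine lintegral_mono fun s => ?_
    rw [enorm_mul]
    refine mul_le_of_le_one_left zero_le ?_
    rw [← ofReal_norm, Real.norm_of_nonneg (hc0 m t s)]
    exact ENNReal.ofReal_le_one.2 (hc1 m t s)
  tendsto t ht g hg := by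
    refine (tendsto_integral_timeMollifier ht hg).congr' ?_
    filter_upwards [h t ht] with m hm
    refine integral_congr_ae (Eventually.of_forall fun s => ?_)
    simp only
    by_cases hs : timeMollifier m (t - s) = 0
    · simp [hs]
    · rw [hm s (abs_le_of_timeMollifier_ne_zero hs), one_mul]

theorem eventually_timeCutoff_eq_one {T t : ℝ} (ht : t ∈ Ioo 0 T) :
    ∀ᶠ m in atTop, ∀ s, |t - s| < timeScale m / 2 → timeCutoff T (timeScale m) s = 1 := by
  have hpos : 0 < min t (T - t) / 3 := by
    have := lt_min ht.1 (sub_pos.2 ht.2)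
    positivity
  filter_upwards [tendsto_timeScale.eventually_lt_const hpos] with m hm s hs
  have h1 := min_le_left t (T - t)
  have h2 := min_le_right t (T - t)
  rw [abs_lt] at hs
  exact timeCutoff_eq_one (timeScale_pos m) (by linarith) (by linarith)

theorem isTimeKernel_left (T : ℝ) :
    IsTimeKernel T fun m t s => timeCutoff T (timeScale m) t * timeMollifier m (t - s) := by
  refine isTimeKernel_of_eventually (c := fun m t _ => timeCutoff T (timeScale m) t)
    (fun m => ?_) (fun _ _ _ => timeCutoff_nonneg) (fun _ _ _ => timeCutoff_le_one) fun t ht => ?_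
  · exact (contDiff_timeCutoff (k := 0)).continuous.comp continuous_fst
  · filter_upwards [eventually_timeCutoff_eq_one ht] with m hm s _
    exact hm t (by simpa using timeScale_pos m)

/-- The same doubled weight with outer and inner time exchanged: the cutoff now sits on the
integrated variable. The mollifier is even. -/
theorem isTimeKernel_right (T : ℝ) :
    IsTimeKernel T fun m t s => timeCutoff T (timeScale m) s * timeMollifier m (s - t) := by
  have h := isTimeKernel_of_eventually (T := T) (c := fun m _ s => timeCutoff T (timeScale m) s)
    (fun m => (contDiff_timeCutoff (k := 0)).continuous.comp continuous_snd)
    (fun _ _ _ => timeCutoff_nonneg) (fun _ _ _ => timeCutoff_le_one)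
    fun t ht => eventually_timeCutoff_eq_one ht
  have heven : ∀ m t s, timeMollifier m (s - t) = timeMollifier m (t - s) := fun m t s => by
    rw [← neg_sub]
    exact (timeBump m).normed_neg _
  simpa only [heven] using h

/-! ### Coordinate calculus for the Laplacian. -/

section Laplacian

variable {n : ℕ}

/-- The partial derivative of `f` in the `i`-th coordinate direction. -/
noncomputable def pderiv (i : Fin n) (f : Rn n → ℝ) (x : Rn n) : ℝ :=
  fderiv ℝ f x (EuclideanSpace.basisFun (Fin n) ℝ i)

theorem ContDiff.pderiv {f : Rn n → ℝ} (hf : ContDiff ℝ ∞ f) (i : Fin n) :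
    ContDiff ℝ ∞ (pderiv i f) :=
  (hf.fderiv_right (m := ∞) (by simp)).clm_apply contDiff_const

theorem pderiv_mul {f g : Rn n → ℝ} (hf : ContDiff ℝ ∞ f) (hg : ContDiff ℝ ∞ g) (i : Fin n) :
    pderiv i (fun x => f x * g x) = fun x => f x * pderiv i g x + g x * pderiv i f x := by
  ext x
  have h := ((hf.differentiable (by simp) x).hasFDerivAt).mul
    ((hg.differentiable (by simp) x).hasFDerivAt)
  simp only [pderiv]
  rw [show (fun x => f x * g x) = f * g from rfl, h.fderiv]
  simp

theorem pderiv_add {f g : Rn n → ℝ} (hf : ContDiff ℝ ∞ f) (hg : ContDiff ℝ ∞ g) (i : Fin n)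
    (x : Rn n) : pderiv i (fun x => f x + g x) x = pderiv i f x + pderiv i g x := by
  have h := ((hf.differentiable (by simp) x).hasFDerivAt).add
    ((hg.differentiable (by simp) x).hasFDerivAt)
  simp only [pderiv]
  rw [show (fun x => f x + g x) = f + g from rfl, h.fderiv]
  simp

theorem pderiv_const_sub {f : Rn n → ℝ} (hf : ContDiff ℝ ∞ f) (i : Fin n) (y : Rn n) :
    pderiv i (fun x => f (y - x)) = fun x => -pderiv i f (y - x) := by
  ext x
  have h := ((hf.differentiable (by simp) (y - x)).hasFDerivAt).comp x
    ((hasFDerivAt_id x).const_sub y)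
  simp only [pderiv]
  rw [show (fun x => f (y - x)) = f ∘ HSub.hSub y from rfl, h.fderiv]
  simp

theorem pderiv_sub_const (f : Rn n → ℝ) (i : Fin n) (y : Rn n) :
    pderiv i (fun x => f (x - y)) = fun x => pderiv i f (x - y) := by
  ext x
  simp only [pderiv, fderiv_comp_sub]

theorem pderiv_const_mul {f : Rn n → ℝ} (c : ℝ) (i : Fin n) :
    pderiv i (fun x => c * f x) = fun x => c * pderiv i f x := by
  ext x
  simp only [pderiv, ← smul_eq_mul]
  rw [show (fun x => c • f x) = c • f from rfl, fderiv_const_smul_field]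
  simp

theorem laplacian_eq_sum_pderiv {f : Rn n → ℝ} (hf : ContDiff ℝ ∞ f) (x : Rn n) :
    Laplacian.laplacian f x = ∑ i, pderiv i (pderiv i f) x := by
  rw [InnerProductSpace.laplacian_eq_iteratedFDeriv_orthonormalBasis f
    (EuclideanSpace.basisFun (Fin n) ℝ)]
  refine Finset.sum_congr rfl fun i _ => ?_
  rw [iteratedFDeriv_two_apply]
  have h : HasFDerivAt (fderiv ℝ f) (fderiv ℝ (fderiv ℝ f) x) x :=
    ((hf.fderiv_right (m := ∞) (by simp)).differentiable (by simp) x).hasFDerivAt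
  have h2 := h.clm_apply (hasFDerivAt_const (EuclideanSpace.basisFun (Fin n) ℝ i) x)
  rw [pderiv, show pderiv i f = fun y =>
    fderiv ℝ f y (EuclideanSpace.basisFun (Fin n) ℝ i) from rfl, h2.fderiv]
  simp

theorem contDiff_laplacian {f : Rn n → ℝ} (hf : ContDiff ℝ ∞ f) :
    ContDiff ℝ ∞ (fun x => Laplacian.laplacian f x) := by
  simp only [laplacian_eq_sum_pderiv hf]
  exact ContDiff.sum fun i _ => (hf.pderiv i).pderiv i

/-- Each `x`-derivative of `ρ(y - x)` brings a sign: the cross term becomes negative, while the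
second-order term keeps its sign. -/
theorem laplacian_mul_const_sub {η ρ : Rn n → ℝ} (hη : ContDiff ℝ ∞ η) (hρ : ContDiff ℝ ∞ ρ)
    (x y : Rn n) :
    Laplacian.laplacian (fun x => η x * ρ (y - x)) x =
      η x * Laplacian.laplacian ρ (y - x) - 2 * ∑ i, pderiv i η x * pderiv i ρ (y - x) +
        Laplacian.laplacian η x * ρ (y - x) := by
  have hρ' : ContDiff ℝ ∞ fun x => ρ (y - x) := hρ.comp (by fun_prop)
  rw [laplacian_eq_sum_pderiv (hη.mul hρ'), laplacian_eq_sum_pderiv hη, laplacian_eq_sum_pderiv hρ]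
  simp only [Finset.mul_sum, Finset.sum_mul, ← Finset.sum_sub_distrib, ← Finset.sum_add_distrib]
  refine Finset.sum_congr rfl fun i _ => ?_
  have h1 : ContDiff ℝ ∞ fun x => pderiv i ρ (y - x) := (hρ.pderiv i).comp (by fun_prop)
  have h2 : pderiv i (fun x => -pderiv i ρ (y - x)) x = pderiv i (pderiv i ρ) (y - x) := by
    have h3 := congrFun (pderiv_const_mul (f := fun x => pderiv i ρ (y - x)) (-1) i) x
    rw [pderiv_const_sub (hρ.pderiv i)] at h3
    simpa using h3
  rw [pderiv_mul hη hρ', pderiv_const_sub hρ,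
    pderiv_add (hη.mul h1.neg) (hρ'.mul (hη.pderiv i)), pderiv_mul hη h1.neg,
    pderiv_mul hρ' (hη.pderiv i), pderiv_const_sub hρ]
  simp only [h2]
  ring

theorem laplacian_const_mul_sub_const {ρ : Rn n → ℝ} (hρ : ContDiff ℝ ∞ ρ) (c : ℝ) (x y : Rn n) :
    Laplacian.laplacian (fun y => c * ρ (y - x)) y = c * Laplacian.laplacian ρ (y - x) := by
  have hρ' : ContDiff ℝ ∞ fun y => c * ρ (y - x) := contDiff_const.mul (hρ.comp (by fun_prop))
  rw [laplacian_eq_sum_pderiv hρ', laplacian_eq_sum_pderiv hρ, Finset.mul_sum]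
  refine Finset.sum_congr rfl fun i _ => ?_
  rw [pderiv_const_mul, pderiv_const_mul, pderiv_sub_const, pderiv_sub_const]

theorem transposeSchrodinger_ofReal_mul {α : ℝ → ℝ} {β : Rn n → ℝ} (hα : Differentiable ℝ α)
    (hβ : ContDiff ℝ ∞ β) (z : ℝ × Rn n) :
    transposeSchrodinger (fun z : ℝ × Rn n => ((α z.1 * β z.2 : ℝ) : ℂ)) z =
      -Complex.I * ((deriv α z.1 * β z.2 : ℝ) : ℂ) +
        ((α z.1 * Laplacian.laplacian β z.2 : ℝ) : ℂ) := by
  have h1 : deriv (fun s : ℝ => ((α s * β z.2 : ℝ) : ℂ)) z.1 =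
      ((deriv α z.1 * β z.2 : ℝ) : ℂ) :=
    ((hα z.1).hasDerivAt.mul_const (β z.2)).ofReal_comp.deriv
  have h2 : Laplacian.laplacian (fun x : Rn n => ((α z.1 * β x : ℝ) : ℂ)) z.2 =
      ((α z.1 * Laplacian.laplacian β z.2 : ℝ) : ℂ) := by
    have h3 := ContDiffAt.laplacian_CLM_comp_left (l := Complex.ofRealCLM)
      (f := fun x : Rn n => α z.1 * β x) (x := z.2)
      (contDiff_infty.1 (contDiff_const.mul hβ) 2).contDiffAt
    have h4 := laplacian_const_mul_sub_const hβ (α z.1) 0 z.2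
    simp only [sub_zero] at h4
    refine h3.trans ?_
    simp [h4]
  simp only [transposeSchrodinger]
  rw [h1, h2]

end Laplacian

/-! ### Doubling of variables. -/

section Doubling

variable {n : ℕ} {T : ℝ} {u v F G : ℝ × Rn n → ℂ}

theorem IsSchrodingerOf.integral_ofReal_mul (h : IsSchrodingerOf T u F) {α : ℝ → ℝ}
    {β : Rn n → ℝ} (hα : ContDiff ℝ ∞ α) (hβ : ContDiff ℝ ∞ β) {S : Set ℝ} (hS : IsCompact S)
    (hST : S ⊆ Ioo 0 T) (hαS : ∀ t, α t ≠ 0 → t ∈ S) (hβ' : HasCompactSupport β) :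
    ∫ z, u z * (-Complex.I * ((deriv α z.1 * β z.2 : ℝ) : ℂ) +
        ((α z.1 * Laplacian.laplacian β z.2 : ℝ) : ℂ))
        ∂(((volume : Measure ℝ).restrict (Ioo 0 T)).prod volume) =
      ∫ z, F z * ((α z.1 * β z.2 : ℝ) : ℂ)
        ∂(((volume : Measure ℝ).restrict (Ioo 0 T)).prod volume) := by
  have hsub : tsupport (fun z : ℝ × Rn n => ((α z.1 * β z.2 : ℝ) : ℂ)) ⊆ S ×ˢ tsupport β := by
    refine closure_minimal (fun z hz => ?_) (hS.isClosed.prod (isClosed_tsupport β))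
    simp only [Function.mem_support, ne_eq, Complex.ofReal_eq_zero, mul_eq_zero, not_or] at hz
    exact ⟨hαS _ hz.1, subset_tsupport β hz.2⟩
  have := h (fun z => ((α z.1 * β z.2 : ℝ) : ℂ))
    (Complex.ofRealCLM.contDiff.comp ((hα.comp contDiff_fst).mul (hβ.comp contDiff_snd)))
    ((hS.prod hβ').of_isClosed_subset (isClosed_tsupport _) hsub)
    (hsub.trans (prod_mono hST (subset_univ _)))
  simpa only [transposeSchrodinger_ofReal_mul (hα.differentiable (by simp)) hβ,
    volume_restrict_slab] using this

theorem IsSchrodingerOf.integral_star_ofReal_mul (h : IsSchrodingerOf T v G) {α : ℝ → ℝ}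
    {β : Rn n → ℝ} (hα : ContDiff ℝ ∞ α) (hβ : ContDiff ℝ ∞ β) {S : Set ℝ} (hS : IsCompact S)
    (hST : S ⊆ Ioo 0 T) (hαS : ∀ t, α t ≠ 0 → t ∈ S) (hβ' : HasCompactSupport β) :
    ∫ z, starRingEnd ℂ (v z) * (Complex.I * ((deriv α z.1 * β z.2 : ℝ) : ℂ) +
        ((α z.1 * Laplacian.laplacian β z.2 : ℝ) : ℂ))
        ∂(((volume : Measure ℝ).restrict (Ioo 0 T)).prod volume) =
      ∫ z, starRingEnd ℂ (G z) * ((α z.1 * β z.2 : ℝ) : ℂ)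
        ∂(((volume : Measure ℝ).restrict (Ioo 0 T)).prod volume) := by
  have := congrArg (starRingEnd ℂ) (h.integral_ofReal_mul hα hβ hS hST hαS hβ')
  rw [← integral_conj, ← integral_conj] at this
  simpa only [map_mul, map_add, map_neg, Complex.conj_I, Complex.conj_ofReal, neg_neg] using this

/-- The commutator kernel `(Δₓ - Δ_y) (η(x) ρ(y - x))`. -/
noncomputable def commKernel (η ρ : Rn n → ℝ) (x y : Rn n) : ℝ :=
  Laplacian.laplacian η x * ρ (y - x) - 2 * ∑ i, pderiv i η x * pderiv i ρ (y - x)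

theorem integrable_mul_mul_of_compact {a b : ℝ × Rn n → ℂ}
    (ha : ∀ R, Integrable (fun z : ℝ × Rn n =>
        a z * (Metric.closedBall (0 : Rn n) R).indicator (fun _ => (1 : ℂ)) z.2)
      (((volume : Measure ℝ).restrict (Ioo 0 T)).prod volume))
    (hb : ∀ R, Integrable (fun z : ℝ × Rn n =>
        b z * (Metric.closedBall (0 : Rn n) R).indicator (fun _ => (1 : ℂ)) z.2)
      (((volume : Measure ℝ).restrict (Ioo 0 T)).prod volume))
    {K : (ℝ × Rn n) × (ℝ × Rn n) → ℂ} (hK : Continuous K) (hK' : HasCompactSupport K) :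
    Integrable (fun w => a w.1 * b w.2 * K w)
      ((((volume : Measure ℝ).restrict (Ioo 0 T)).prod volume).prod
          (((volume : Measure ℝ).restrict (Ioo 0 T)).prod volume)) := by
  obtain ⟨C, hC⟩ := hK.bounded_above_of_compact_support hK'
  obtain ⟨R, hR⟩ := hK'.isBounded.subset_closedBall 0
  have hmem : ∀ w, K w ≠ 0 → ‖w‖ ≤ R := fun w hw => by
    simpa using hR (subset_tsupport K hw)
  refine integrable_mul_mul_of_support (R := R) (C := C) (ha R) (hb R) hK hC ?_ ?_
  · intro w hw
    rw [mem_closedBall_zero_iff]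
    exact (norm_snd_le w.1).trans ((norm_fst_le w).trans (hmem w hw))
  · intro w hw
    rw [mem_closedBall_zero_iff]
    exact (norm_snd_le w.2).trans ((norm_snd_le w).trans (hmem w hw))

theorem support_pderiv_subset (i : Fin n) (f : Rn n → ℝ) :
    Function.support (pderiv i f) ⊆ tsupport f := by
  intro x hx
  refine support_fderiv_subset ℝ fun h => hx ?_
  simp [pderiv, h]

theorem support_laplacian_subset {f : Rn n → ℝ} (hf : ContDiff ℝ ∞ f) :
    Function.support (fun x => Laplacian.laplacian f x) ⊆ tsupport f := by
  intro x hx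
  rw [Function.mem_support, laplacian_eq_sum_pderiv hf] at hx
  obtain ⟨i, -, hi⟩ := Finset.exists_ne_zero_of_sum_ne_zero hx
  exact closure_minimal (support_pderiv_subset i f) (isClosed_tsupport f)
    (support_pderiv_subset i _ hi)

theorem commKernel_ne_zero {η ρ : Rn n → ℝ} (hη : ContDiff ℝ ∞ η) {x y : Rn n}
    (h : commKernel η ρ x y ≠ 0) : x ∈ tsupport η ∧ y - x ∈ tsupport ρ := by
  constructor
  · by_contra hx
    have h1 : Laplacian.laplacian η x = 0 := by_contra fun h0 => hx (support_laplacian_subset hη h0)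
    have h2 : ∀ i, pderiv i η x = 0 := fun i => by_contra fun h0 =>
      hx (support_pderiv_subset i η h0)
    simp [commKernel, h1, h2] at h
  · by_contra hx
    have h1 : ρ (y - x) = 0 := by_contra fun h0 => hx (subset_tsupport ρ h0)
    have h2 : ∀ i, pderiv i ρ (y - x) = 0 := fun i => by_contra fun h0 =>
      hx (support_pderiv_subset i ρ h0)
    simp [commKernel, h1, h2] at h

theorem continuous_commKernel {η ρ : Rn n → ℝ} (hη : ContDiff ℝ ∞ η) (hρ : ContDiff ℝ ∞ ρ) :
    Continuous fun w : Rn n × Rn n => commKernel η ρ w.1 w.2 := by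
  have h1 := (contDiff_laplacian hη).continuous
  have h2 := hρ.continuous
  have h3 := fun i => (hη.pderiv i).continuous
  have h4 := fun i => (hρ.pderiv i).continuous
  unfold commKernel
  fun_prop

/-- In the coordinates `(t, x, t - s, y - x)` the support lies in a product of compact sets, and the
change of coordinates is continuous. -/
theorem hasCompactSupport_of_support {A : Set (Rn n)} {B : Set (Rn n)} (hA : IsCompact A)
    (hB : IsCompact B) {K : (ℝ × Rn n) × (ℝ × Rn n) → ℂ} {a b c d : ℝ}
    (hK : ∀ w, K w ≠ 0 → w.1.1 ∈ Icc a b ∧ w.1.1 - w.2.1 ∈ Icc c d ∧ w.1.2 ∈ A ∧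
      w.2.2 - w.1.2 ∈ B) : HasCompactSupport K := by
  have hS : IsCompact ((fun w : (ℝ × Rn n) × (ℝ × Rn n) =>
      (w.1, (w.1.1 - w.2.1, w.1.2 + w.2.2))) '' ((Icc a b ×ˢ A) ×ˢ (Icc c d ×ˢ B))) :=
    ((isCompact_Icc.prod hA).prod (isCompact_Icc.prod hB)).image (by fun_prop)
  refine HasCompactSupport.intro hS fun w hw => by_contra fun h0 => hw ?_
  obtain ⟨h1, h2, h3, h4⟩ := hK w h0
  exact ⟨(w.1, (w.1.1 - w.2.1, w.2.2 - w.1.2)), ⟨⟨h1, h3⟩, ⟨h2, h4⟩⟩, by simp⟩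

/-- Testing in `(t,x)` with `(s,y)` frozen, and conversely, gives the same terms in `θ'` and `η Δρ`:
passing from `t` to `s` flips the sign of `θ'`, but conjugation flips that of `i`. Subtraction
leaves `χ'` and the commutator. -/
theorem doubled_identity (huF : IsSchrodingerOf T u F) (hvG : IsSchrodingerOf T v G)
    (hu : ∀ R, Integrable (fun z : ℝ × Rn n =>
        u z * (Metric.closedBall (0 : Rn n) R).indicator (fun _ => (1 : ℂ)) z.2)
      (((volume : Measure ℝ).restrict (Ioo 0 T)).prod volume))
    (hF : ∀ R, Integrable (fun z : ℝ × Rn n =>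
        F z * (Metric.closedBall (0 : Rn n) R).indicator (fun _ => (1 : ℂ)) z.2)
      (((volume : Measure ℝ).restrict (Ioo 0 T)).prod volume))
    (hv : ∀ R, Integrable (fun z : ℝ × Rn n => starRingEnd ℂ (v z) *
        (Metric.closedBall (0 : Rn n) R).indicator (fun _ => (1 : ℂ)) z.2)
      (((volume : Measure ℝ).restrict (Ioo 0 T)).prod volume))
    (hG : ∀ R, Integrable (fun z : ℝ × Rn n => starRingEnd ℂ (G z) *
        (Metric.closedBall (0 : Rn n) R).indicator (fun _ => (1 : ℂ)) z.2)
      (((volume : Measure ℝ).restrict (Ioo 0 T)).prod volume))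
    {χ θ : ℝ → ℝ} {η ρ : Rn n → ℝ} (hχ : ContDiff ℝ ∞ χ) (hθ : ContDiff ℝ ∞ θ)
    (hη : ContDiff ℝ ∞ η) (hρ : ContDiff ℝ ∞ ρ) (hη' : HasCompactSupport η)
    (hρ' : HasCompactSupport ρ) {δ : ℝ} (hχδ : ∀ t, χ t ≠ 0 → t ∈ Icc δ (T - δ))
    (hθδ : ∀ t, θ t ≠ 0 → |t| ≤ δ / 2) (hδ : 0 < δ) :
    (∫ w, F w.1 * starRingEnd ℂ (v w.2) *
        ((χ w.1.1 * θ (w.1.1 - w.2.1) * (η w.1.2 * ρ (w.2.2 - w.1.2)) : ℝ) : ℂ)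
        ∂((((volume : Measure ℝ).restrict (Ioo 0 T)).prod volume).prod
          (((volume : Measure ℝ).restrict (Ioo 0 T)).prod volume))) -
      (∫ w, u w.1 * starRingEnd ℂ (G w.2) *
        ((χ w.1.1 * θ (w.1.1 - w.2.1) * (η w.1.2 * ρ (w.2.2 - w.1.2)) : ℝ) : ℂ)
        ∂((((volume : Measure ℝ).restrict (Ioo 0 T)).prod volume).prod
          (((volume : Measure ℝ).restrict (Ioo 0 T)).prod volume))) =
    -Complex.I * (∫ w, u w.1 * starRingEnd ℂ (v w.2) *
        ((deriv χ w.1.1 * θ (w.1.1 - w.2.1) * (η w.1.2 * ρ (w.2.2 - w.1.2)) : ℝ) : ℂ)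
        ∂((((volume : Measure ℝ).restrict (Ioo 0 T)).prod volume).prod
          (((volume : Measure ℝ).restrict (Ioo 0 T)).prod volume))) +
      ∫ w, u w.1 * starRingEnd ℂ (v w.2) *
        ((χ w.1.1 * θ (w.1.1 - w.2.1) * commKernel η ρ w.1.2 w.2.2 : ℝ) : ℂ)
        ∂((((volume : Measure ℝ).restrict (Ioo 0 T)).prod volume).prod
          (((volume : Measure ℝ).restrict (Ioo 0 T)).prod volume)) := by
  set μ := ((volume : Measure ℝ).restrict (Ioo 0 T)).prod (volume : Measure (Rn n)) with hμ
  have hχ1 : ∀ t, deriv χ t ≠ 0 → t ∈ Icc δ (T - δ) := fun t ht =>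
    closure_minimal (fun s hs => hχδ s hs) isClosed_Icc (support_deriv_subset ht)
  have hθ0 : ∀ t, θ t ≠ 0 → t ∈ Icc (-(δ / 2)) (δ / 2) := fun t ht => abs_le.1 (hθδ t ht)
  have hθ1 : ∀ t, deriv θ t ≠ 0 → t ∈ Icc (-(δ / 2)) (δ / 2) := fun t ht =>
    closure_minimal (fun s hs => hθ0 s hs) isClosed_Icc (support_deriv_subset ht)
  have hk : ∀ x y, η x * ρ (y - x) ≠ 0 → x ∈ tsupport η ∧ y - x ∈ tsupport ρ := fun x y h =>
    ⟨subset_tsupport η (left_ne_zero_of_mul h), subset_tsupport ρ (right_ne_zero_of_mul h)⟩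
  have hl : ∀ x y, η x * Laplacian.laplacian ρ (y - x) ≠ 0 → x ∈ tsupport η ∧ y - x ∈ tsupport ρ :=
    fun x y h => ⟨subset_tsupport η (left_ne_zero_of_mul h),
      support_laplacian_subset hρ (right_ne_zero_of_mul h)⟩
  have cη := hη.continuous
  have cρ := hρ.continuous
  have cχ := hχ.continuous
  have cθ := hθ.continuous
  have cχ' : Continuous (deriv χ) := hχ.continuous_deriv (by simp)
  have cθ' : Continuous (deriv θ) := hθ.continuous_deriv (by simp)
  have cΔ : Continuous fun x => Laplacian.laplacian ρ x := (contDiff_laplacian hρ).continuous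
  have cc := continuous_commKernel hη hρ
  have hcomp : ∀ {f g : ℝ → ℝ} {k : Rn n → Rn n → ℝ},
      (∀ t, f t ≠ 0 → t ∈ Icc δ (T - δ)) → (∀ t, g t ≠ 0 → t ∈ Icc (-(δ / 2)) (δ / 2)) →
      (∀ x y, k x y ≠ 0 → x ∈ tsupport η ∧ y - x ∈ tsupport ρ) →
      HasCompactSupport fun w : (ℝ × Rn n) × (ℝ × Rn n) =>
        ((f w.1.1 * g (w.1.1 - w.2.1) * k w.1.2 w.2.2 : ℝ) : ℂ) := by
    intro f g k hf hg hk
    refine hasCompactSupport_of_support (a := δ) (b := T - δ) (c := -(δ / 2)) (d := δ / 2)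
      hη' hρ' fun w hw => ?_
    have h := Complex.ofReal_ne_zero.1 hw
    have h1 := left_ne_zero_of_mul h
    exact ⟨hf _ (left_ne_zero_of_mul h1), hg _ (right_ne_zero_of_mul h1),
      hk _ _ (right_ne_zero_of_mul h)⟩
  have iFv := integrable_mul_mul_of_compact hF hv (K := fun w =>
    ((χ w.1.1 * θ (w.1.1 - w.2.1) * (η w.1.2 * ρ (w.2.2 - w.1.2)) : ℝ) : ℂ)) (by fun_prop)
    (hcomp (k := fun x y => η x * ρ (y - x)) hχδ hθ0 hk)
  have iuG := integrable_mul_mul_of_compact hu hG (K := fun w =>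
    ((χ w.1.1 * θ (w.1.1 - w.2.1) * (η w.1.2 * ρ (w.2.2 - w.1.2)) : ℝ) : ℂ)) (by fun_prop)
    (hcomp (k := fun x y => η x * ρ (y - x)) hχδ hθ0 hk)
  have i1 := integrable_mul_mul_of_compact hu hv (K := fun w =>
    ((deriv χ w.1.1 * θ (w.1.1 - w.2.1) * (η w.1.2 * ρ (w.2.2 - w.1.2)) : ℝ) : ℂ)) (by fun_prop)
    (hcomp (k := fun x y => η x * ρ (y - x)) hχ1 hθ0 hk)
  have i2 := integrable_mul_mul_of_compact hu hv (K := fun w =>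
    ((χ w.1.1 * deriv θ (w.1.1 - w.2.1) * (η w.1.2 * ρ (w.2.2 - w.1.2)) : ℝ) : ℂ)) (by fun_prop)
    (hcomp (k := fun x y => η x * ρ (y - x)) hχδ hθ1 hk)
  have i3 := integrable_mul_mul_of_compact hu hv (K := fun w =>
    ((χ w.1.1 * θ (w.1.1 - w.2.1) * (η w.1.2 * Laplacian.laplacian ρ (w.2.2 - w.1.2)) : ℝ) : ℂ))
    (by fun_prop)
    (hcomp (k := fun x y => η x * Laplacian.laplacian ρ (y - x)) hχδ hθ0 hl)
  have i4 := integrable_mul_mul_of_compact hu hv (K := fun w =>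
    ((χ w.1.1 * θ (w.1.1 - w.2.1) * commKernel η ρ w.1.2 w.2.2 : ℝ) : ℂ)) (by fun_prop)
    (hcomp (k := commKernel η ρ) hχδ hθ0 fun x y h => commKernel_ne_zero hη h)
  -- The right side is grouped so that its second bracket is verbatim the right side of `hB`, and
  -- cancels against it at the end.
  have hA : ∫ w, F w.1 * starRingEnd ℂ (v w.2) *
        ((χ w.1.1 * θ (w.1.1 - w.2.1) * (η w.1.2 * ρ (w.2.2 - w.1.2)) : ℝ) : ℂ) ∂(μ.prod μ) =
      ∫ w, (-Complex.I * (u w.1 * starRingEnd ℂ (v w.2) *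
          ((deriv χ w.1.1 * θ (w.1.1 - w.2.1) * (η w.1.2 * ρ (w.2.2 - w.1.2)) : ℝ) : ℂ)) +
        u w.1 * starRingEnd ℂ (v w.2) *
          ((χ w.1.1 * θ (w.1.1 - w.2.1) * commKernel η ρ w.1.2 w.2.2 : ℝ) : ℂ)) +
        (-Complex.I * (u w.1 * starRingEnd ℂ (v w.2) *
          ((χ w.1.1 * deriv θ (w.1.1 - w.2.1) * (η w.1.2 * ρ (w.2.2 - w.1.2)) : ℝ) : ℂ)) +
        u w.1 * starRingEnd ℂ (v w.2) *
          ((χ w.1.1 * θ (w.1.1 - w.2.1) *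
            (η w.1.2 * Laplacian.laplacian ρ (w.2.2 - w.1.2)) : ℝ) : ℂ)) ∂(μ.prod μ) := by
    -- With `(s,y)` as outer variable, the inner integral is the equation for `u` tested in `(t,x)`.
    rw [integral_prod_symm _ iFv]
    refine Eq.trans ?_ (integral_prod_symm _ (((i1.const_mul (-Complex.I)).add i4).add
      ((i2.const_mul (-Complex.I)).add i3))).symm
    refine integral_congr_ae (Eventually.of_forall fun w => ?_)
    have h := huF.integral_ofReal_mul (α := fun t => χ t * θ (t - w.1))
      (β := fun x => η x * ρ (w.2 - x)) (S := Icc δ (T - δ)) (hχ.mul (hθ.comp (by fun_prop)))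
      (hη.mul (hρ.comp (by fun_prop))) isCompact_Icc
      (Icc_subset_Ioo hδ (by linarith)) (fun t ht => hχδ t (left_ne_zero_of_mul ht))
      hη'.mul_right
    have h' := congrArg (fun c => starRingEnd ℂ (v w) * c) h
    simp only [← integral_const_mul] at h'
    refine Eq.trans ?_ (h'.symm.trans ?_)
    · refine integral_congr_ae (Eventually.of_forall fun z => ?_)
      simp only
      ring
    · refine integral_congr_ae (Eventually.of_forall fun z => ?_)
      have hd : deriv (fun t => χ t * θ (t - w.1)) z.1 =
          deriv χ z.1 * θ (z.1 - w.1) + χ z.1 * deriv θ (z.1 - w.1) := by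
        have h1 := (hχ.differentiable (by simp) z.1).hasDerivAt
        have h2 := (hθ.differentiable (by simp) (z.1 - w.1)).hasDerivAt.comp z.1
          ((hasDerivAt_id z.1).sub_const w.1)
        exact (h1.mul h2).deriv.trans (by simp)
      simp only
      rw [hd, laplacian_mul_const_sub hη hρ]
      simp only [commKernel, Pi.add_apply]
      push_cast
      ring
  have hB : ∫ w, u w.1 * starRingEnd ℂ (G w.2) *
        ((χ w.1.1 * θ (w.1.1 - w.2.1) * (η w.1.2 * ρ (w.2.2 - w.1.2)) : ℝ) : ℂ) ∂(μ.prod μ) =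
      ∫ w, -Complex.I * (u w.1 * starRingEnd ℂ (v w.2) *
          ((χ w.1.1 * deriv θ (w.1.1 - w.2.1) * (η w.1.2 * ρ (w.2.2 - w.1.2)) : ℝ) : ℂ)) +
        u w.1 * starRingEnd ℂ (v w.2) *
          ((χ w.1.1 * θ (w.1.1 - w.2.1) *
            (η w.1.2 * Laplacian.laplacian ρ (w.2.2 - w.1.2)) : ℝ) : ℂ) ∂(μ.prod μ) := by
    rw [integral_prod _ iuG]
    refine Eq.trans ?_ (integral_prod _ ((i2.const_mul (-Complex.I)).add i3)).symm
    refine integral_congr_ae (Eventually.of_forall fun w => ?_)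
    have hsupp : HasCompactSupport fun y => η w.2 * ρ (y - w.2) :=
      (hρ'.comp_homeomorph (Homeomorph.subRight w.2)).mul_left
    -- With `(t,x)` frozen, `s` lies within `δ/2` of a point of `[δ, T - δ]`, hence in the compact
    -- interval chosen for `S`.
    have h := hvG.integral_star_ofReal_mul (α := fun s => χ w.1 * θ (w.1 - s))
      (β := fun y => η w.2 * ρ (y - w.2)) (S := Icc (δ / 2) (T - δ / 2))
      (contDiff_const.mul (hθ.comp (by fun_prop)))
      (contDiff_const.mul (hρ.comp (by fun_prop))) isCompact_Icc
      (Icc_subset_Ioo (by linarith) (by linarith)) (fun s hs => ?_) hsupp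
    · have h' := congrArg (fun c => u w * c) h
      simp only [← integral_const_mul] at h'
      refine Eq.trans ?_ (h'.symm.trans ?_)
      · refine integral_congr_ae (Eventually.of_forall fun z => ?_)
        simp only
        ring
      · refine integral_congr_ae (Eventually.of_forall fun z => ?_)
        have hd : deriv (fun s => χ w.1 * θ (w.1 - s)) z.1 = -(χ w.1 * deriv θ (w.1 - z.1)) := by
          have h2 := (hθ.differentiable (by simp) (w.1 - z.1)).hasDerivAt.comp z.1
            ((hasDerivAt_id z.1).const_sub w.1)
          exact (h2.const_mul (χ w.1)).deriv.trans (by simp)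
        simp only [Pi.add_apply]
        rw [hd, laplacian_const_mul_sub_const hρ]
        push_cast
        ring
    · have h1 := hχδ _ (left_ne_zero_of_mul hs)
      have h2 := hθ0 _ (right_ne_zero_of_mul hs)
      exact ⟨by linarith [h1.1, h2.2], by linarith [h1.2, h2.1]⟩
  have hs := integral_add ((i1.const_mul (-Complex.I)).add i4) ((i2.const_mul (-Complex.I)).add i3)
  have hs' := integral_add (i1.const_mul (-Complex.I)) i4
  rw [integral_const_mul] at hs'
  simp only [Pi.add_apply] at hs hs'
  rw [hA, hB, hs, add_sub_cancel_right, hs']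

end Doubling

/-! ### Passage to the time diagonal. -/

theorem exists_isCutoffKernel {n : ℕ} {k : Rn n → Rn n → ℝ} {A B : Set (Rn n)}
    (hk : Continuous fun w : Rn n × Rn n => k w.1 w.2) (hA : IsCompact A) (hB : IsCompact B)
    (h : ∀ x y, k x y ≠ 0 → x ∈ A ∧ y - x ∈ B) : ∃ R M, IsCutoffKernel k R M := by
  have hS : IsCompact ((fun w : Rn n × Rn n => (w.1, w.1 + w.2)) '' (A ×ˢ B)) :=
    (hA.prod hB).image (by fun_prop)
  have hmem : ∀ x y, k x y ≠ 0 →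
      (x, y) ∈ (fun w : Rn n × Rn n => (w.1, w.1 + w.2)) '' (A ×ˢ B) := fun x y hxy =>
    ⟨(x, y - x), h x y hxy, by simp⟩
  have hcs : HasCompactSupport fun w : Rn n × Rn n => k w.1 w.2 :=
    HasCompactSupport.intro hS fun w hw => by_contra fun h0 => hw (hmem w.1 w.2 h0)
  obtain ⟨M, hM⟩ := hk.bounded_above_of_compact_support hcs
  obtain ⟨R, hR⟩ := hS.isBounded.subset_closedBall 0
  refine ⟨R, M, hk, fun x y hxy => ?_, fun x y hxy => ?_, fun x y => hM (x, y)⟩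
  · have := hR (hmem x y hxy)
    rw [mem_closedBall_zero_iff] at this ⊢
    exact (norm_fst_le (x, y)).trans this
  · have := hR (hmem x y hxy)
    rw [mem_closedBall_zero_iff] at this ⊢
    exact (norm_snd_le (x, y)).trans this

/-- The equations for `u` and `conj v` tested against `η(x) ρ(y - x)` on the time diagonal. -/
theorem localized_identity {n : ℕ} {T : ℝ} (hT : 0 < T) {p r' p' : ℝ≥0∞} (hp : 1 < p)
    (hp' : p ≠ ⊤) (hr1 : 1 ≤ r') (hq1 : 1 < p') (hq' : p' ≠ ⊤) {u v F G : ℝ × Rn n → ℂ}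
    (hv : MemContLp T p v) (hu : MemContLp T 2 u)
    (hu0 : (fun x : Rn n => u (0, x)) =ᵐ[volume] 0)
    (huT : (fun x : Rn n => u (T, x)) =ᵐ[volume] 0)
    (hF : MemMixed T r' p' F) (hG : MemMixed T r' p' G)
    (huF : IsSchrodingerOf T u F) (hvG : IsSchrodingerOf T v G)
    {η ρ : Rn n → ℝ} (hη : ContDiff ℝ ∞ η) (hρ : ContDiff ℝ ∞ ρ) (hη' : HasCompactSupport η)
    (hρ' : HasCompactSupport ρ) :
    (∫ z, F z * kernelIntegral (fun x y => η x * ρ (y - x)) (fun z => starRingEnd ℂ (v z)) z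
        ∂(((volume : Measure ℝ).restrict (Ioo 0 T)).prod volume)) -
      (∫ z, starRingEnd ℂ (G z) * kernelIntegral (fun y x => η x * ρ (y - x)) u z
        ∂(((volume : Measure ℝ).restrict (Ioo 0 T)).prod volume)) =
    ∫ z, u z * kernelIntegral (commKernel η ρ) (fun z => starRingEnd ℂ (v z)) z
        ∂(((volume : Measure ℝ).restrict (Ioo 0 T)).prod volume) := by
  have h2 : (1 : ℝ≥0∞) < 2 := by norm_num
  have iu := fun R => (hu.memMixed_top h2.le).integrable_mul_indicator le_top h2 (by simp) R
  have iv := fun R => (hv.star.memMixed_top hp.le).integrable_mul_indicator le_top hp hp' R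
  have iF := fun R => hF.integrable_mul_indicator hr1 hq1 hq' R
  have iG := fun R => hG.star.integrable_mul_indicator hr1 hq1 hq' R
  have cη := hη.continuous
  have cρ := hρ.continuous
  obtain ⟨R, M, hκ⟩ := exists_isCutoffKernel (k := fun x y => η x * ρ (y - x)) (by fun_prop) hη' hρ'
    fun x y h => ⟨subset_tsupport η (left_ne_zero_of_mul h),
      subset_tsupport ρ (right_ne_zero_of_mul h)⟩
  obtain ⟨R', M', hE⟩ := exists_isCutoffKernel (continuous_commKernel hη hρ) hη' hρ'
    fun x y h => commKernel_ne_zero hη h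
  obtain ⟨D, hD, hD'⟩ := exists_lintegral_deriv_timeCutoff_le
  have l1 := tendsto_integral_timeKernel (isTimeKernel_left T) hκ hp.le hv.star (iF R) (iv R)
  -- Here `G` carries the outer variable `(s,y)` and `u` is smoothed, so both the spatial kernel and
  -- the time kernel appear with their arguments exchanged.
  have l2 := tendsto_integral_timeKernel (isTimeKernel_right T) hκ.swap h2.le hu (iG R) (iu R)
  have l4 := tendsto_integral_timeKernel (isTimeKernel_left T) hE hp.le hv.star (iu R') (iv R')
  have l3 := tendsto_integral_boundary (T := T) (k := fun m => deriv (timeCutoff T (timeScale m)))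
    (ψ := fun m t s => timeMollifier m (t - s))
    (fun m => (continuous_timeMollifier m).comp (by fun_prop))
    (fun m t => (setLIntegral_le_lintegral _ _).trans (lintegral_timeMollifier m t).le)
    (fun m => (contDiff_timeCutoff (k := 1)).continuous_deriv le_rfl) hD
    (fun m => hD' T (timeScale m) (timeScale_pos m))
    (fun δ hδ => by
      -- The cutoff is flat only from twice its scale onwards, hence `δ / 2`.
      filter_upwards [tendsto_timeScale.eventually_lt_const (half_pos hδ)] with m hm t ht
      exact deriv_timeCutoff_eq_zero (timeScale_pos m) (by linarith [ht.1]) (by linarith [ht.2]))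
    hκ hp.le hv.star h2.le hu hu0 huT hT
  refine tendsto_nhds_unique (l1.sub l2) ?_
  have l5 := (l3.const_mul (-Complex.I)).add l4
  rw [mul_zero, zero_add] at l5
  refine l5.congr fun m => ?_
  refine (doubled_identity huF hvG iu iF iv iG contDiff_timeCutoff
    (timeBump m).contDiff_normed hη hρ hη' hρ'
    (fun t ht => mem_of_timeCutoff_ne_zero (timeScale_pos m) ht)
    (fun t ht => (abs_le_of_timeMollifier_ne_zero ht).le) (timeScale_pos m)).symm.trans ?_
  congr 1
  -- The doubled identity has `u` in the first slot and `G` in the second; the limit `l2` uses the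
  -- opposite order.
  rw [← integral_prod_swap]
  refine integral_congr_ae (Eventually.of_forall fun w => ?_)
  simp only [Prod.fst_swap, Prod.snd_swap, timeMollifier]
  ring

/-! ### Removing the spatial cutoff from the main terms. -/

namespace IsPaired

variable {n : ℕ} {ν : Measure ℝ} [SFinite ν] {p q : ℝ≥0∞} [p.HolderConjugate q]
  {a b : ℝ × Rn n → ℂ}

theorem lintegral_kernel_le (h : IsPaired ν p q a b) {ρ : Rn n → ℝ}
    (hρ : AEStronglyMeasurable ρ volume) :
    ∫⁻ z, (‖a z‖ₑ * ∫⁻ y, ‖b (z.1, y)‖ₑ * ‖ρ (y - z.2)‖ₑ) ∂(ν.prod volume) ≤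
      (∫⁻ t, eLpNorm (fun x => a (t, x)) p volume * eLpNorm (fun x => b (t, x)) q volume ∂ν) *
        ∫⁻ ζ, ‖ρ ζ‖ₑ := by
  refine le_trans (le_of_eq ?_) (h.lintegral_translate_kernel_le hρ)
  have hm : AEMeasurable (fun w : (ℝ × Rn n) × Rn n =>
      ‖a w.1‖ₑ * ‖b (w.1.1, w.1.2 + w.2)‖ₑ * ‖ρ w.2‖ₑ) ((ν.prod volume).prod volume) :=
    (h.left_meas.comp_fst.enorm.mul
      (h.right_meas.comp_quasiMeasurePreserving quasiMeasurePreserving_translate).enorm).mul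
      hρ.comp_snd.enorm
  rw [lintegral_prod _ hm]
  refine lintegral_congr fun z => ?_
  rw [← lintegral_add_left_eq_self (μ := volume)
    (fun y : Rn n => ‖b (z.1, y)‖ₑ * ‖ρ (y - z.2)‖ₑ) z.2,
    ← lintegral_const_mul' ‖a z‖ₑ _ enorm_ne_top]
  simp only [add_sub_cancel_left, mul_assoc]

/-- Dominated convergence on the triple integral, which converges absolutely by `integrable_kernel`.
The cutoff may depend on either spatial point, since it falls on the outer one in one term and on
the inner one in the other. -/
theorem tendsto_integral_cutoff (h : IsPaired ν p q a b) {ρ : Rn n → ℝ}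
    (hρ : Integrable ρ volume) {c : ℕ → (ℝ × Rn n) × Rn n → ℝ} (hc : ∀ m, Continuous (c m))
    (hc1 : ∀ m w, ‖c m w‖ ≤ 1) (hlim : ∀ w, Tendsto (fun m => c m w) atTop (𝓝 1)) :
    Tendsto (fun m => ∫ z, (a z * ∫ y, b (z.1, y) * ((c m (z, y) * ρ (y - z.2) : ℝ) : ℂ))
        ∂(ν.prod volume)) atTop
      (𝓝 (∫ z, (a z * ∫ y, b (z.1, y) * (ρ (y - z.2) : ℂ)) ∂(ν.prod volume))) := by
  have hi := h.integrable_kernel hρ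
  have hi' : ∀ m, Integrable (fun w : (ℝ × Rn n) × Rn n =>
      a w.1 * b (w.1.1, w.2) * (ρ (w.2 - w.1.2) : ℂ) * (c m w : ℂ))
      ((ν.prod volume).prod volume) := fun m =>
    hi.mul_bdd (c := 1) (Complex.continuous_ofReal.comp (hc m)).aestronglyMeasurable
      (Eventually.of_forall fun w => by simpa using hc1 m w)
  have e1 : ∀ m, ∫ z, (a z * ∫ y, b (z.1, y) * ((c m (z, y) * ρ (y - z.2) : ℝ) : ℂ))
        ∂(ν.prod volume) = ∫ w, a w.1 * b (w.1.1, w.2) * (ρ (w.2 - w.1.2) : ℂ) * (c m w : ℂ)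
        ∂((ν.prod volume).prod volume) := fun m => by
    rw [integral_prod _ (hi' m)]
    refine integral_congr_ae (Eventually.of_forall fun z => ?_)
    simp only
    rw [← integral_const_mul]
    congr 1
    ext y
    push_cast
    ring
  have e2 : ∫ z, (a z * ∫ y, b (z.1, y) * (ρ (y - z.2) : ℂ)) ∂(ν.prod volume) =
      ∫ w, a w.1 * b (w.1.1, w.2) * (ρ (w.2 - w.1.2) : ℂ) ∂((ν.prod volume).prod volume) := by
    rw [integral_prod _ hi]
    refine integral_congr_ae (Eventually.of_forall fun z => ?_)
    simp only
    rw [← integral_const_mul]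
    congr 1
    ext y
    ring
  simp only [e1, e2]
  refine tendsto_integral_of_dominated_convergence _ (fun m => (hi' m).1) hi.norm
    (fun m => Eventually.of_forall fun w => ?_) (Eventually.of_forall fun w => ?_)
  · rw [norm_mul]
    refine mul_le_of_le_one_right (norm_nonneg _) ?_
    simpa using hc1 m w
  · have := (Complex.continuous_ofReal.tendsto 1).comp (hlim w)
    simpa using this.const_mul (a w.1 * b (w.1.1, w.2) * (ρ (w.2 - w.1.2) : ℂ))

end IsPaired

theorem tendsto_eLpNorm_tail {n : ℕ} {p : ℝ≥0∞} (hp0 : p ≠ 0) (hp : p ≠ ⊤) {f : Rn n → ℂ}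
    (hf : MemLp f p volume) :
    Tendsto (fun m : ℕ => eLpNorm ({x : Rn n | (m : ℝ) + 1 ≤ ‖x‖}.indicator f) p volume)
      atTop (𝓝 0) := by
  have hpos : 0 < p.toReal := ENNReal.toReal_pos hp0 hp
  have hms : ∀ m : ℕ, MeasurableSet {x : Rn n | (m : ℝ) + 1 ≤ ‖x‖} := fun m =>
    measurableSet_le measurable_const measurable_norm
  simp only [eLpNorm_eq_lintegral_rpow_enorm_toReal hp0 hp]
  have key : Tendsto (fun m : ℕ => ∫⁻ x, ‖{x : Rn n | (m : ℝ) + 1 ≤ ‖x‖}.indicator f x‖ₑ ^ p.toReal)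
      atTop (𝓝 (∫⁻ _ : Rn n, 0)) := by
    refine tendsto_lintegral_of_dominated_convergence' (fun x => ‖f x‖ₑ ^ p.toReal)
      (fun m => (hf.1.indicator (hms m)).enorm.pow_const _)
      (fun m => Eventually.of_forall fun x => ?_)
      (lintegral_rpow_enorm_lt_top_of_eLpNorm_lt_top hp0 hp hf.2).ne
      (Eventually.of_forall fun x => ?_)
    · simp only
      gcongr
      exact enorm_indicator_le_enorm_self f x
    · refine tendsto_const_nhds.congr' ?_
      obtain ⟨N, hN⟩ := exists_nat_gt ‖x‖
      filter_upwards [eventually_ge_atTop N] with m hm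
      have : x ∉ {x : Rn n | (m : ℝ) + 1 ≤ ‖x‖} := by
        have : (N : ℝ) ≤ m := by exact_mod_cast hm
        simp only [mem_ofPred_eq, not_le]
        linarith
      rw [indicator_of_notMem this]
      simp [hpos]
  rw [lintegral_zero] at key
  have := key.ennrpow_const (1 / p.toReal)
  rwa [ENNReal.zero_rpow_of_pos (by positivity)] at this

/-! ### Large spatial cutoffs and decay of the commutator. -/

section SpaceCutoff

variable {n : ℕ}

/-- A smooth bump function equal to `1` on the unit ball and supported in the ball of radius `2`. -/
noncomputable def unitBump (n : ℕ) : ContDiffBump (0 : Rn n) where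
  rIn := 1
  rOut := 2
  rIn_pos := one_pos
  rIn_lt_rOut := one_lt_two

/-- A smooth cutoff equal to `1` where `‖x‖ ≤ R` and supported where `‖x‖ ≤ 2 R`. -/
noncomputable def spaceCutoff (R : ℝ) (x : Rn n) : ℝ := unitBump n (R⁻¹ • x)

theorem contDiff_spaceCutoff (R : ℝ) : ContDiff ℝ ∞ (spaceCutoff (n := n) R) :=
  (unitBump n).contDiff.comp (by fun_prop)

theorem norm_spaceCutoff_le_one (R : ℝ) (x : Rn n) : ‖spaceCutoff R x‖ ≤ 1 := by
  rw [spaceCutoff, Real.norm_of_nonneg (unitBump n).nonneg]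
  exact (unitBump n).le_one

theorem spaceCutoff_eq_one {R : ℝ} (hR : 0 < R) {x : Rn n} (hx : ‖x‖ ≤ R) :
    spaceCutoff R x = 1 := by
  refine (unitBump n).one_of_mem_closedBall ?_
  rw [mem_closedBall_zero_iff, norm_smul, norm_inv, Real.norm_of_nonneg hR.le]
  show R⁻¹ * ‖x‖ ≤ 1
  rwa [inv_mul_le_iff₀ hR, mul_one]

theorem tsupport_spaceCutoff_subset {R : ℝ} (hR : 0 < R) :
    tsupport (spaceCutoff (n := n) R) ⊆ Metric.closedBall 0 (R * 2) := by
  refine closure_minimal (fun x hx => ?_) Metric.isClosed_closedBall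
  have h : R⁻¹ • x ∈ Function.support (unitBump n) := hx
  rw [ContDiffBump.support_eq, mem_ball_zero_iff, norm_smul, norm_inv,
    Real.norm_of_nonneg hR.le] at h
  have h' : R⁻¹ * ‖x‖ < 2 := h
  rw [inv_mul_lt_iff₀ hR] at h'
  exact mem_closedBall_zero_iff.2 h'.le

theorem hasCompactSupport_spaceCutoff {R : ℝ} (hR : 0 < R) :
    HasCompactSupport (spaceCutoff (n := n) R) :=
  (isCompact_closedBall 0 (R * 2)).of_isClosed_subset (isClosed_tsupport _)
    (tsupport_spaceCutoff_subset hR)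

theorem pderiv_comp_const_smul {f : Rn n → ℝ} (i : Fin n) (c : ℝ) :
    pderiv i (fun x => f (c • x)) = fun x => c * pderiv i f (c • x) := by
  ext x
  simp only [pderiv, fderiv_comp_smul]
  simp

theorem laplacian_spaceCutoff (R : ℝ) (x : Rn n) :
    Laplacian.laplacian (spaceCutoff R) x =
      R⁻¹ * (R⁻¹ * Laplacian.laplacian (unitBump n : Rn n → ℝ) (R⁻¹ • x)) := by
  rw [laplacian_eq_sum_pderiv (contDiff_spaceCutoff R),
    laplacian_eq_sum_pderiv (unitBump n).contDiff, Finset.mul_sum, Finset.mul_sum]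
  refine Finset.sum_congr rfl fun i _ => ?_
  have h1 : pderiv i (spaceCutoff R) = fun x : Rn n => R⁻¹ * pderiv i (unitBump n) (R⁻¹ • x) :=
    pderiv_comp_const_smul i _
  rw [h1, pderiv_const_mul, pderiv_comp_const_smul]

theorem pderiv_spaceCutoff_of_norm_lt {R : ℝ} (hR : 0 < R) {x : Rn n} (hx : ‖x‖ < R) (i : Fin n) :
    pderiv i (spaceCutoff R) x = 0 := by
  have h : spaceCutoff R =ᶠ[𝓝 x] fun _ => (1 : ℝ) := by
    filter_upwards [(isOpen_lt continuous_norm continuous_const).mem_nhds hx] with y hy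
    exact spaceCutoff_eq_one hR (le_of_lt hy)
  rw [pderiv, h.fderiv_eq]
  simp

theorem laplacian_spaceCutoff_of_norm_lt {R : ℝ} (hR : 0 < R) {x : Rn n} (hx : ‖x‖ < R) :
    Laplacian.laplacian (spaceCutoff R) x = 0 := by
  rw [laplacian_eq_sum_pderiv (contDiff_spaceCutoff R)]
  refine Finset.sum_eq_zero fun i _ => ?_
  have h : pderiv i (spaceCutoff R) =ᶠ[𝓝 x] fun _ => (0 : ℝ) := by
    filter_upwards [(isOpen_lt continuous_norm continuous_const).mem_nhds hx] with y hy
    exact pderiv_spaceCutoff_of_norm_lt hR hy i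
  rw [pderiv, h.fderiv_eq]
  simp

/-- The kernel dominating the commutator kernels of all large cutoffs. -/
noncomputable def commMajorant (ρ : Rn n → ℝ) (ζ : Rn n) : ℝ :=
  ‖ρ ζ‖ + 2 * ∑ i, ‖pderiv i ρ ζ‖

/-- Every term of the commutator has a derivative on the cutoff. Scaling gives `1/R` for first
derivatives and `1/R² ≤ 1/R` for the Laplacian, and all of them vanish off the annulus. -/
theorem exists_norm_commKernel_spaceCutoff_le (n : ℕ) : ∃ C : ℝ, ∀ R : ℝ, 1 ≤ R →
    ∀ (ρ : Rn n → ℝ) (x y : Rn n), ‖commKernel (spaceCutoff R) ρ x y‖ ≤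
      ({x : Rn n | R ≤ ‖x‖} ∩ Metric.closedBall 0 (R * 2)).indicator (fun _ => C / R) x *
        commMajorant ρ (y - x) := by
  have hη : ContDiff ℝ ∞ (unitBump n) := (unitBump n).contDiff
  have hb : ∀ f : Rn n → ℝ, Continuous f → Function.support f ⊆ tsupport (unitBump n) →
      ∃ C, ∀ x, ‖f x‖ ≤ C := fun f hf hs => hf.bounded_above_of_compact_support
    ((unitBump n).hasCompactSupport.mono' hs)
  obtain ⟨C₁, h₁⟩ := hb _ (contDiff_laplacian hη).continuous (support_laplacian_subset hη)
  choose C₂ h₂ using fun i : Fin n => hb _ (hη.pderiv i).continuous (support_pderiv_subset i _)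
  set C := max C₁ (∑ i, |C₂ i|)
  have hC₁ : C₁ ≤ C := le_max_left _ _
  have hC₂ : ∀ i, C₂ i ≤ C := fun i => (le_abs_self _).trans
    ((Finset.single_le_sum (f := fun i => |C₂ i|) (fun _ _ => abs_nonneg _)
      (Finset.mem_univ i)).trans (le_max_right _ _))
  have hC0 : 0 ≤ C := (norm_nonneg _).trans ((h₁ 0).trans hC₁)
  refine ⟨C, fun R hR ρ x y => ?_⟩
  have hR0 : 0 < R := by linarith
  have hinv : R⁻¹ ≤ 1 := inv_le_one_of_one_le₀ hR
  by_cases hx : x ∈ {x : Rn n | R ≤ ‖x‖} ∩ Metric.closedBall 0 (R * 2)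
  · have hL : ‖Laplacian.laplacian (spaceCutoff R) x‖ ≤ C / R := by
      rw [laplacian_spaceCutoff, norm_mul, norm_mul, norm_inv, Real.norm_of_nonneg hR0.le,
        div_eq_inv_mul]
      gcongr
      calc R⁻¹ * ‖Laplacian.laplacian (unitBump n : Rn n → ℝ) (R⁻¹ • x)‖ ≤ 1 * C := by
            gcongr
            exact (h₁ _).trans hC₁
        _ = C := one_mul C
    have hP : ∀ i, ‖pderiv i (spaceCutoff R) x‖ ≤ C / R := fun i => by
      have h1 : pderiv i (spaceCutoff R) x = R⁻¹ * pderiv i (unitBump n) (R⁻¹ • x) :=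
        congrFun (pderiv_comp_const_smul i _) x
      rw [h1, norm_mul, norm_inv, Real.norm_of_nonneg hR0.le, div_eq_inv_mul]
      gcongr
      exact (h₂ i _).trans (hC₂ i)
    rw [indicator_of_mem hx, commKernel, commMajorant, mul_add]
    refine (norm_sub_le _ _).trans (add_le_add ?_ ?_)
    · rw [norm_mul]
      gcongr
    · rw [norm_mul, Real.norm_two, mul_left_comm, Finset.mul_sum]
      gcongr
      refine (norm_sum_le _ _).trans (Finset.sum_le_sum fun i _ => ?_)
      rw [norm_mul]
      gcongr
      exact hP i
  · rw [indicator_of_notMem hx, zero_mul, norm_le_zero_iff]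
    rw [mem_inter_iff, not_and_or] at hx
    rcases hx with hx | hx
    · have hx' : ‖x‖ < R := not_le.1 hx
      simp [commKernel, laplacian_spaceCutoff_of_norm_lt hR0 hx',
        pderiv_spaceCutoff_of_norm_lt hR0 hx']
    · by_contra h0
      exact hx (tsupport_spaceCutoff_subset hR0 (commKernel_ne_zero (contDiff_spaceCutoff R) h0).1)

theorem integrable_commMajorant {ρ : Rn n → ℝ} (hρ : ContDiff ℝ ∞ ρ) (hρ' : HasCompactSupport ρ) :
    Integrable (commMajorant ρ) volume := by
  have h1 := hρ.continuous
  have h2 := fun i => (hρ.pderiv i).continuous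
  refine Continuous.integrable_of_hasCompactSupport (by unfold commMajorant; fun_prop)
    (HasCompactSupport.intro hρ' fun x hx => ?_)
  have h3 : ρ x = 0 := by_contra fun h0 => hx (subset_tsupport ρ h0)
  have h4 : ∀ i, pderiv i ρ x = 0 := fun i => by_contra fun h0 =>
    hx (support_pderiv_subset i ρ h0)
  simp [commMajorant, h3, h4]

/-- The norm is at most a constant times `R^(n/q - 1)`, bounded for `R ≥ 1` exactly because `n/q ≤
1`. For `q = ∞` the convention `1 / q.toReal = 0` gives the right exponent. -/
theorem eLpNorm_annulus_le {q : ℝ≥0∞} (hq : (n : ℝ) * (1 / q.toReal) ≤ 1) (C : ℝ) {R : ℝ}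
    (hR : 1 ≤ R) :
    eLpNorm (({x : Rn n | R ≤ ‖x‖} ∩ Metric.closedBall 0 (R * 2)).indicator fun _ => C / R) q
      volume ≤ ‖C‖ₑ * volume (Metric.closedBall (0 : Rn n) 2) ^ (1 / q.toReal) := by
  have hR0 : 0 < R := by linarith
  calc _ ≤ ‖C / R‖ₑ * volume ({x : Rn n | R ≤ ‖x‖} ∩ Metric.closedBall 0 (R * 2)) ^
          (1 / q.toReal) := eLpNorm_indicator_const_le _ _
    _ ≤ ‖C / R‖ₑ * volume (Metric.closedBall (0 : Rn n) (R * 2)) ^ (1 / q.toReal) := by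
        gcongr
        exact inter_subset_right
    _ = ‖C / R‖ₑ * (ENNReal.ofReal (R ^ n) ^ (1 / q.toReal) *
          volume (Metric.closedBall (0 : Rn n) 2) ^ (1 / q.toReal)) := by
        rw [Measure.addHaar_closedBall_mul volume 0 hR0.le zero_le_two, finrank_euclideanSpace_fin,
          ENNReal.mul_rpow_of_nonneg _ _ (by positivity)]
    _ ≤ ‖C / R‖ₑ * (ENNReal.ofReal R *
          volume (Metric.closedBall (0 : Rn n) 2) ^ (1 / q.toReal)) := by
        gcongr
        rw [ENNReal.ofReal_rpow_of_pos (by positivity)]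
        refine ENNReal.ofReal_le_ofReal ?_
        rw [← Real.rpow_natCast, ← Real.rpow_mul hR0.le]
        calc R ^ ((n : ℝ) * (1 / q.toReal)) ≤ R ^ (1 : ℝ) := Real.rpow_le_rpow_of_exponent_le hR hq
          _ = R := Real.rpow_one R
    _ = _ := by
        rw [← mul_assoc, ← ofReal_norm (C / R), ← ENNReal.ofReal_mul (norm_nonneg _), norm_div,
          Real.norm_of_nonneg hR0.le, div_mul_cancel₀ _ hR0.ne', ofReal_norm]

end SpaceCutoff

/-- Hölder with exponents `2`, `q`, `p` bounds the commutator by the `L²` norm of `u` on `|x| ≥ R`,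
times the bounded annulus norm, the norm of `b` and the mass of `commMajorant`. The tail tends to
zero for each `t` and is bounded in `t`, so dominated convergence applies. -/
theorem tendsto_commutator {n : ℕ} {T : ℝ} {p p' q : ℝ≥0∞} [p'.HolderConjugate p]
    [ENNReal.HolderTriple 2 q p'] (hq : (n : ℝ) * (1 / q.toReal) ≤ 1)
    {u b : ℝ × Rn n → ℂ} (hu : MemContLp T 2 u) (hb : MemContLp T p b) {ρ : Rn n → ℝ}
    (hρ : ContDiff ℝ ∞ ρ) (hρ' : HasCompactSupport ρ) :
    Tendsto (fun m : ℕ => ∫ z, u z * kernelIntegral (commKernel (spaceCutoff ((m : ℝ) + 1)) ρ) b z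
        ∂(((volume : Measure ℝ).restrict (Ioo 0 T)).prod volume)) atTop (𝓝 0) := by
  obtain ⟨C, hC⟩ := exists_norm_commKernel_spaceCutoff_le n
  obtain ⟨Cu, hCu, hCu'⟩ := hu.exists_eLpNorm_le (by norm_num)
  obtain ⟨Cb, hCb, hCb'⟩ := hb.exists_eLpNorm_le (ENNReal.HolderConjugate.one_le p p')
  set W : ℝ≥0∞ := ‖C‖ₑ * volume (Metric.closedBall (0 : Rn n) 2) ^ (1 / q.toReal) with hW
  have hW' : W ≠ ⊤ := ENNReal.mul_ne_top enorm_ne_top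
    (ENNReal.rpow_ne_top_of_nonneg (by positivity) (measure_closedBall_lt_top).ne)
  set g : ℕ → Rn n → ℝ := fun m => ({x : Rn n | (m : ℝ) + 1 ≤ ‖x‖} ∩
    Metric.closedBall 0 (((m : ℝ) + 1) * 2)).indicator fun _ => C / ((m : ℝ) + 1) with hg
  set tail : ℕ → ℝ → ℝ≥0∞ := fun m t =>
    eLpNorm ({x : Rn n | (m : ℝ) + 1 ≤ ‖x‖}.indicator fun x => u (t, x)) 2 volume with htail
  have hm1 : ∀ m : ℕ, (1 : ℝ) ≤ (m : ℝ) + 1 := fun m => by simp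
  have hms : ∀ m : ℕ, MeasurableSet {x : Rn n | (m : ℝ) + 1 ≤ ‖x‖} := fun m =>
    measurableSet_le measurable_const measurable_norm
  have hgm : ∀ m, Measurable (g m) := fun m =>
    measurable_const.indicator ((hms m).inter Metric.isClosed_closedBall.measurableSet)
  -- Attaching the annulus weight to `u` moves it from `L²` to `L^{p'}`, so that it pairs with `b`
  -- through the kernel estimate for Hölder-dual functions.
  set a : ℕ → ℝ × Rn n → ℂ := fun m z => u z * (g m z.2 : ℂ) with ha
  have ham : ∀ m, AEStronglyMeasurable (a m)
      (((volume : Measure ℝ).restrict (Ioo 0 T)).prod volume) := fun m =>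
    hu.aestronglyMeasurable.mul
      (Complex.measurable_ofReal.comp ((hgm m).comp measurable_snd)).aestronglyMeasurable
  have haslice : ∀ m : ℕ, ∀ t ∈ Icc 0 T, eLpNorm (fun x => a m (t, x)) p' volume ≤ tail m t * W := by
    intro m t ht
    have h1 : (fun x => a m (t, x)) =
        ({x : Rn n | (m : ℝ) + 1 ≤ ‖x‖}.indicator fun x => u (t, x)) • fun x => (g m x : ℂ) := by
      ext x
      by_cases hx : x ∈ {x : Rn n | (m : ℝ) + 1 ≤ ‖x‖}
      · simp [ha, indicator_of_mem hx]
      · have hx' : g m x = 0 := indicator_of_notMem (fun h => hx h.1) _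
        simp [ha, hx']
    rw [h1]
    refine (eLpNorm_smul_le_mul_eLpNorm (p := 2) (q := q)
      (Complex.measurable_ofReal.comp (hgm m)).aestronglyMeasurable
      ((hu.2.1 t ht).1.indicator (hms m))).trans ?_
    gcongr
    refine le_trans (le_of_eq ?_) (eLpNorm_annulus_le hq C (hm1 m))
    exact eLpNorm_congr_norm_ae (Eventually.of_forall fun x => Complex.norm_real _)
  have htail_le : ∀ m : ℕ, ∀ t ∈ Icc 0 T, tail m t ≤ Cu := fun m t ht =>
    (eLpNorm_indicator_le _).trans (hCu' t ht)
  have hprod : ∀ m : ℕ, ∀ t ∈ Icc 0 T, eLpNorm (fun x => a m (t, x)) p' volume *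
      eLpNorm (fun x => b (t, x)) p volume ≤ tail m t * (W * Cb) := fun m t ht => by
    rw [← mul_assoc]
    exact mul_le_mul' (haslice m t ht) (hCb' t ht)
  have hfin : ∀ m : ℕ, ∀ t ∈ Icc 0 T, tail m t * (W * Cb) ≤ Cu * (W * Cb) := fun m t ht =>
    mul_le_mul' (htail_le m t ht) le_rfl
  have hCfin : Cu * (W * Cb) ≠ ⊤ := ENNReal.mul_ne_top hCu (ENNReal.mul_ne_top hW' hCb)
  have hconst : ∫⁻ _ in Ioo (0 : ℝ) T, Cu * (W * Cb) ≠ ⊤ := by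
    rw [setLIntegral_const]
    exact ENNReal.mul_ne_top hCfin (by simp)
  have hpair : ∀ m : ℕ, IsPaired ((volume : Measure ℝ).restrict (Ioo 0 T)) p' p (a m) b := fun m =>
    { left_meas := ham m
      right_meas := hb.aestronglyMeasurable
      left_slice := by
        filter_upwards [ae_aestronglyMeasurable_slice (ham m), ae_restrict_mem measurableSet_Ioo]
          with t h1 ht
        have ht' := Ioo_subset_Icc_self ht
        exact ⟨h1, ((haslice m t ht').trans (mul_le_mul' (htail_le m t ht') le_rfl)).trans_lt
          (ENNReal.mul_lt_top hCu.lt_top hW'.lt_top)⟩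
      right_slice := by
        filter_upwards [ae_restrict_mem measurableSet_Ioo] with t ht
        exact hb.2.1 t (Ioo_subset_Icc_self ht)
      lintegral_lt_top := by
        refine lt_of_le_of_lt (setLIntegral_mono_ae' measurableSet_Ioo
          (Eventually.of_forall fun t ht => ?_)) hconst.lt_top
        have ht' := Ioo_subset_Icc_self ht
        exact (hprod m t ht').trans (hfin m t ht') }
  have hK := integrable_commMajorant hρ hρ'
  have hbound : ∀ m : ℕ, ‖∫ z, u z * kernelIntegral (commKernel (spaceCutoff ((m : ℝ) + 1)) ρ) b z
      ∂(((volume : Measure ℝ).restrict (Ioo 0 T)).prod volume)‖ₑ ≤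
      (∫⁻ t in Ioo 0 T, tail m t * (W * Cb)) * ∫⁻ ζ, ‖commMajorant ρ ζ‖ₑ := by
    intro m
    refine (enorm_integral_le_lintegral_enorm _).trans ?_
    calc _ ≤ ∫⁻ z, (‖a m z‖ₑ * ∫⁻ y, ‖b (z.1, y)‖ₑ * ‖commMajorant ρ (y - z.2)‖ₑ)
          ∂(((volume : Measure ℝ).restrict (Ioo 0 T)).prod volume) := by
          refine lintegral_mono fun z => ?_
          simp only [ha]
          rw [enorm_mul, enorm_mul, mul_assoc]
          refine mul_le_mul' le_rfl ((enorm_integral_le_lintegral_enorm _).trans ?_)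
          rw [← lintegral_const_mul' _ _ enorm_ne_top]
          refine lintegral_mono fun y => ?_
          simp only
          rw [enorm_mul, mul_left_comm, enorm_ofReal_complex, enorm_ofReal_complex, ← enorm_mul]
          refine mul_le_mul' le_rfl (enorm_le_iff_norm_le.2 ?_)
          exact (hC _ (hm1 m) ρ z.2 y).trans (le_abs_self _)
      _ ≤ _ := (hpair m).lintegral_kernel_le hK.1
      _ ≤ _ := by
          refine mul_le_mul' (setLIntegral_mono_ae' measurableSet_Ioo
            (Eventually.of_forall fun t ht => ?_)) le_rfl
          exact hprod m t (Ioo_subset_Icc_self ht)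
  have htends : Tendsto (fun m : ℕ => ∫⁻ t in Ioo 0 T, tail m t * (W * Cb)) atTop (𝓝 0) := by
    rw [← lintegral_zero (μ := (volume : Measure ℝ).restrict (Ioo 0 T))]
    refine tendsto_lintegral_of_dominated_convergence' (fun _ => Cu * (W * Cb)) (fun m => ?_)
      (fun m => ?_) hconst ?_
    · have h1 : AEStronglyMeasurable (({z : ℝ × Rn n | (m : ℝ) + 1 ≤ ‖z.2‖}).indicator u)
          (((volume : Measure ℝ).restrict (Ioo 0 T)).prod volume) :=
        hu.aestronglyMeasurable.indicator (measurable_snd (hms m))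
      exact (aemeasurable_eLpNorm_slice h1 two_ne_zero (by simp)).mul_const _
    · filter_upwards [ae_restrict_mem measurableSet_Ioo] with t ht
      exact hfin m t (Ioo_subset_Icc_self ht)
    · filter_upwards [ae_restrict_mem measurableSet_Ioo] with t ht
      have h1 := tendsto_eLpNorm_tail two_ne_zero (by simp) (hu.2.1 t (Ioo_subset_Icc_self ht))
      have h2 := ENNReal.Tendsto.mul_const h1 (b := W * Cb)
        (Or.inr (ENNReal.mul_ne_top hW' hCb))
      rwa [zero_mul] at h2
  have h0 := ENNReal.Tendsto.mul_const htends (b := ∫⁻ ζ, ‖commMajorant ρ ζ‖ₑ) (Or.inr hK.2.ne)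
  rw [zero_mul] at h0
  rw [tendsto_iff_edist_tendsto_0]
  simp only [edist_zero_right]
  exact tendsto_of_tendsto_of_tendsto_of_le_of_le tendsto_const_nhds h0 (fun _ => zero_le) hbound

/-! ### Strichartz exponents and conclusion. -/

/-- If `p = ∞`, then `n/2 = 2/r ≤ 1` forces `n = 2` and `r = 2`, the excluded triple. -/
theorem IsStrichartzPair.ne_top {n : ℕ} (hn : 2 ≤ n) {r p : ℝ≥0∞} (h : IsStrichartzPair n r p) :
    p ≠ ⊤ := by
  rintro rfl
  obtain ⟨h1, h2, -, h4⟩ := h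
  rw [ENNReal.div_top, add_zero] at h1
  have hr : 2 / r ≤ 1 := ENNReal.div_le_of_le_mul (by simpa using h2)
  have hn2 : (n : ℝ≥0∞) ≤ 2 := by
    rw [h1] at hr
    simpa using (ENNReal.div_le_iff two_ne_zero (by simp)).1 hr
  have hn' : n = 2 := le_antisymm (by exact_mod_cast hn2) hn
  subst hn'
  refine h4 ⟨rfl, ?_, rfl⟩
  rw [Nat.cast_ofNat, ENNReal.div_self two_ne_zero (by simp)] at h1
  have hr0 : r ≠ 0 := by
    rintro rfl
    simp at h2
  have hrt : r ≠ ⊤ := by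
    rintro rfl
    simp at h1
  exact ((ENNReal.div_eq_one_iff hr0 hrt).1 h1).symm

theorem IsStrichartzPair.exists_holderTriple {n : ℕ} {r p : ℝ≥0∞}
    (h : IsStrichartzPair n r p) : ∃ q : ℝ≥0∞, ENNReal.HolderTriple 2 q p.conjExponent ∧
      (n : ℝ) * (1 / q.toReal) ≤ 1 := by
  obtain ⟨h1, h2, h3, -⟩ := h
  have hp1 : 1 ≤ p := le_trans (by norm_num) h3
  have hpi : p⁻¹ ≤ 2⁻¹ := ENNReal.inv_le_inv.2 h3
  have hpit : p⁻¹ ≠ ⊤ := ENNReal.inv_ne_top.2 (by positivity)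
  have hpc : p.HolderConjugate p.conjExponent := .conjExponent hp1
  -- With `1/q = 1/2 - 1/p`, one has `1/2 + 1/q = 1 - 1/p` and `n/q = n/2 - n/p = 2/r ≤ 1`.
  refine ⟨(2⁻¹ - p⁻¹)⁻¹, ⟨?_⟩, ?_⟩
  · rw [inv_inv]
    refine (ENNReal.add_right_inj hpit).1 ?_
    rw [ENNReal.HolderConjugate.inv_add_inv_eq_one, add_left_comm, add_tsub_cancel_of_le hpi,
      ENNReal.inv_two_add_inv_two]
  · have hnp : (n : ℝ≥0∞) * p⁻¹ ≠ ⊤ := ENNReal.mul_ne_top (by simp) hpit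
    have e1 : (n : ℝ≥0∞) * (2⁻¹ - p⁻¹) = 2 / r := by
      rw [ENNReal.mul_sub (by simp)]
      rw [div_eq_mul_inv (n : ℝ≥0∞) p, div_eq_mul_inv (n : ℝ≥0∞) 2] at h1
      rw [← h1, ENNReal.add_sub_cancel_right hnp]
    have hr : 2 / r ≤ 1 := ENNReal.div_le_of_le_mul (by simpa using h2)
    rw [ENNReal.toReal_inv, one_div, inv_inv, ← ENNReal.toReal_natCast, ← ENNReal.toReal_mul, e1]
    exact ENNReal.toReal_le_of_le_ofReal zero_le_one (by simpa using hr)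

theorem mainTheorem6 (n : ℕ) (hn : 2 ≤ n) (T : ℝ) (hT : 0 < T)
    (r p : ℝ≥0∞) (hrp : IsStrichartzPair n r p)
    (u v F G : ℝ × Rn n → ℂ)
    (hv : MemContLp T p v)
    (hu : MemContLp T 2 u) (hu' : MemMixed T r p u)
    (hu0 : (fun x : Rn n => u (0, x)) =ᵐ[volume] 0)
    (huT : (fun x : Rn n => u (T, x)) =ᵐ[volume] 0)
    (hF : MemMixed T (ENNReal.conjExponent r) (ENNReal.conjExponent p) F)
    (hG : MemMixed T (ENNReal.conjExponent r) (ENNReal.conjExponent p) G)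
    (huF : IsSchrodingerOf T u F)
    (hvG : IsSchrodingerOf T v G) :
    IntegrableOn (fun z => F z * starRingEnd ℂ (v z)) (slab n T) volume ∧
    IntegrableOn (fun z => u z * starRingEnd ℂ (G z)) (slab n T) volume ∧
    ∫ z in slab n T, F z * starRingEnd ℂ (v z) = ∫ z in slab n T, u z * starRingEnd ℂ (G z) := by
  have hp := hrp.ne_top hn
  obtain ⟨q, hq, hq1⟩ := hrp.exists_holderTriple
  obtain ⟨-, hr2, hp2, -⟩ := hrp
  have hp1 : 1 < p := lt_of_lt_of_le (by norm_num) hp2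
  have hr1 : 1 ≤ r := le_trans (by norm_num) hr2
  have hpc : p.HolderConjugate p.conjExponent := .conjExponent hp1.le
  have hpc' : p.conjExponent.HolderConjugate p := hpc.symm
  have hrc : r.HolderConjugate r.conjExponent := .conjExponent hr1
  have hrc' : r.conjExponent.HolderConjugate r := hrc.symm
  have h1t : ENNReal.HolderConjugate 1 ⊤ := .one_top
  have hp't : p.conjExponent ≠ ⊤ := by
    simpa [ENNReal.conjExponent, tsub_eq_zero_iff_le] using hp1
  have hp'1 : 1 < p.conjExponent :=
    (ENNReal.HolderConjugate.lt_top_iff_one_lt p p.conjExponent).1 hp.lt_top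
  have hr'1 : 1 ≤ r.conjExponent := ENNReal.HolderConjugate.one_le _ r
  -- As `v` is bounded in time with values in `L^p`, it is paired with `F` in `L¹` in time; the
  -- pairing of `G` with `u` uses `u ∈ L^r L^p`.
  have hFv := (hF.exponent_one hr'1 (by positivity) hp't).isPaired
    (hv.star.memMixed_top hp1.le) hp't hp
  have hGu := hG.star.isPaired hu' hp't hp
  have key : ∀ ρ : Rn n → ℝ, ContDiff ℝ ∞ ρ → HasCompactSupport ρ →
      ∫ z, (F z * ∫ y, starRingEnd ℂ (v (z.1, y)) * (ρ (y - z.2) : ℂ))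
        ∂(((volume : Measure ℝ).restrict (Ioo 0 T)).prod volume) =
      ∫ z, (starRingEnd ℂ (G z) * ∫ x, u (z.1, x) * (ρ (z.2 - x) : ℂ))
        ∂(((volume : Measure ℝ).restrict (Ioo 0 T)).prod volume) := by
    intro ρ hρ hρ'
    have hρi : Integrable ρ volume := hρ.continuous.integrable_of_hasCompactSupport hρ'
    have hlim : ∀ x : Rn n, Tendsto (fun m : ℕ => spaceCutoff ((m : ℝ) + 1) x) atTop (𝓝 1) := by
      intro x
      refine tendsto_const_nhds.congr' ?_
      obtain ⟨N, hN⟩ := exists_nat_gt ‖x‖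
      filter_upwards [eventually_ge_atTop N] with m hm
      have hm' : (N : ℝ) ≤ m := by exact_mod_cast hm
      exact (spaceCutoff_eq_one (by positivity) (by linarith)).symm
    have l1 := hFv.tendsto_integral_cutoff hρi
      (c := fun m w => spaceCutoff ((m : ℝ) + 1) w.1.2)
      (fun m => (contDiff_spaceCutoff _).continuous.comp (by fun_prop))
      (fun m w => norm_spaceCutoff_le_one _ _) (fun w => hlim w.1.2)
    -- In this term the cutoff point `x` is the inner variable and the outer one is `y`, so the
    -- kernel appears reflected.
    have l2 := hGu.tendsto_integral_cutoff (ρ := fun ζ => ρ (-ζ)) hρi.comp_neg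
      (c := fun m w => spaceCutoff ((m : ℝ) + 1) w.2)
      (fun m => (contDiff_spaceCutoff _).continuous.comp (by fun_prop))
      (fun m w => norm_spaceCutoff_le_one _ _) (fun w => hlim w.2)
    simp only [neg_sub] at l2
    have l3 := tendsto_commutator (p' := p.conjExponent) hq1 hu hv.star hρ hρ'
    refine sub_eq_zero.1 (tendsto_nhds_unique (l1.sub l2) (l3.congr fun m => ?_))
    exact (localized_identity hT hp1 hp hr'1 hp'1 hp't hv hu hu0 huT hF hG huF hvG
      (contDiff_spaceCutoff ((m : ℝ) + 1)) hρ (hasCompactSupport_spaceCutoff (by positivity))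
      hρ').symm
  have hM := hFv.continuous_integral_translate hp't hp
  have hN := hGu.continuous_integral_translate hp't hp
  set M : Rn n → ℂ := fun ζ => ∫ z, F z * starRingEnd ℂ (v (z.1, z.2 + ζ))
    ∂(((volume : Measure ℝ).restrict (Ioo 0 T)).prod volume)
  set N : Rn n → ℂ := fun ζ => ∫ z, starRingEnd ℂ (G z) * u (z.1, z.2 + ζ)
    ∂(((volume : Measure ℝ).restrict (Ioo 0 T)).prod volume)
  have hN' : Continuous fun ζ => N (-ζ) := hN.comp continuous_neg
  -- Testing against all smooth compactly supported `ρ` gives equality almost everywhere, and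
  -- continuity upgrades it to every shift. The sign of `ζ` reflects the exchanged roles of `x` and
  -- `y`, and is harmless at `0`.
  have hMN : M = fun ζ => N (-ζ) := by
    refine (hM.ae_eq_iff_eq volume hN').1 ?_
    refine ae_eq_of_integral_contDiff_smul_eq hM.locallyIntegrable hN'.locallyIntegrable
      fun ρ hρ hρ' => ?_
    have hρi : Integrable ρ volume := hρ.continuous.integrable_of_hasCompactSupport hρ'
    have h := key ρ hρ hρ'
    rw [hFv.integral_kernel_eq hρi] at h
    have h2 := hGu.integral_kernel_eq (ρ := fun ζ => ρ (-ζ)) hρi.comp_neg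
    simp only [neg_sub] at h2
    have h3 := integral_neg_eq_self (fun ζ => (ρ (-ζ) : ℂ) * N ζ) volume
    simp only [neg_neg] at h3
    simpa only [Complex.real_smul] using h.trans (h2.trans h3.symm)
  have h0 : M 0 = N 0 := by simpa using congrFun hMN 0
  have hcomm : (fun z => u z * starRingEnd ℂ (G z)) = fun z => starRingEnd ℂ (G z) * u z :=
    funext fun z => mul_comm _ _
  rw [IntegrableOn, IntegrableOn, volume_restrict_slab, hcomm]
  exact ⟨hFv.integrable_mul, hGu.integrable_mul, by simpa [M, N] using h0⟩
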